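/- Let $K$ be a number field of degree $d$ over $\mathbb{Q}$ with ring of integers $\mathcal{O}_K$, and let $\mathfrak{d}$ be the absolute value of its discriminant. For a place $v$ of $K$ let $K_v$ be the completion, with $|\cdot|_v$ the normalized absolute value if $v$ is finite. An *Arakelov bundle* $\mathcal{E}$ is a finitely generated projective $\mathcal{O}_K$-module $\mathcal{E}_{\mathcal{O}_K}$ together with a euclidean (resp. hermitian) scalar product $\langle\cdot,\cdot\rangle_v$ on $\mathcal{E}_{K_v}=\mathcal{E}_{\mathcal{O}_K}\otimes K_v$ for every real (resp. complex) place $v$. For $e\in\mathcal{E}_{K_v}$ put $\|e\|_{\mathcal{E},v}=\sqrt{\langle e,e\rangle_v}$ if $v$ is real, $\|e\|_{\mathcal{E},v}=\langle e,e\rangle_v$ if $v$ is complex, and $\|e\|_{\mathcal{E},v}=\min\{|a|_v : a\in K_v,\ e\in a\cdot\mathcal{E}_{\mathcal{O}_v}\}$ if $v$ is finite. The set of global sections is $$\Gamma(\mathcal{E})=\{e\in\mathcal{E}_K : \|e\|_{\mathcal{E},v}\le 1\text{ for all places } v\}.$$ The degree of an Arakelov line bundle $\mathcal{L}$ is $\deg\mathcal{L}=-\log\prod_v\|s\|_{\mathcal{L},v}$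 for any $0\ne s\in\mathcal{L}_K$; in general $\deg\mathcal{E}=\deg(\det\mathcal{E})$, and $\mu(\mathcal{E})=\deg(\mathcal{E})/\mathrm{rk}(\mathcal{E})$ is the slope. A subbundle of $\mathcal{E}$ is a direct summand of $\mathcal{E}_{\mathcal{O}_K}$ with the restricted scalar products, and for $1\le l\le\mathrm{rk}(\mathcal{E})$ we let $\mu_{\max}^{(l)}(\mathcal{E})$ be the supremum of the slopes of the subbundles of $\mathcal{E}$ of rank $l$. The tensor product $\mathcal{E}\otimes\mathcal{F}$ carries the tensor product scalar products. **Proposition.** For every $\varepsilon>0$ there is an integer $n(\varepsilon)$ such that the following holds for every nonzero Arakelov bundle $\mathcal{E}$, every integer $n>n(\varepsilon)$ and every real number $\mu$. If $$\mu_{\max}^{(l)}(\mathcal{E})+\mu\ \ge\ \frac d2\bigl(\log n+\log l-\log\pi-1+\log 2+\varepsilon\bigr)+\frac{\log\mathfrak{d}}2$$ for at least one integer $l$ with $1\le l\le\mathrm{rk}(\mathcal{E})$, then there is no Arakelov bundle $\mathcal{F}$ of rank $n$ and slope $\mu$ with $\Gamma(\mathcal{E}\otimes\mathcal{F})=0$.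 -/

import Mathlib

open scoped TensorProduct
open NumberField IsDedekindDomain

universe u w₁ w₂

noncomputable section

namespace Arakelov

/-! ### Completions at infinite places as `RCLike` fields

For a real place `v` the completion `K_v` is (a copy of) `ℝ` with trivial conjugation, for a complex
place it is a copy of `ℂ` with complex conjugation. Everything is transported along the isometric
embedding `K_v → ℂ` of Mathlib. -/

section Completion

variable {K : Type u} [Field K] (v : InfinitePlace K)

open InfinitePlace.Completion

/-- The embedding `K_v → ℂ`. -/
abbrev sigma : v.Completion →+* ℂ := extensionEmbedding v

theorem norm_sigma (x : v.Completion) : ‖sigma v x‖ = ‖x‖ :=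
  (isometry_extensionEmbedding v).norm_map_of_map_zero (map_zero _) x

theorem sigma_injective : Function.Injective (sigma v) := (sigma v).injective

theorem sigma_im_of_isReal (hv : v.IsReal) (x : v.Completion) : (sigma v x).im = 0 := by
  rw [← extensionEmbeddingOfIsReal_apply hv, Complex.ofReal_im]

theorem isComplex_of_not_isReal (hv : ¬ v.IsReal) : v.IsComplex :=
  InfinitePlace.not_isReal_iff_isComplex.mp hv

open Classical in
/-- The embedding `ℝ → K_v`. -/
def ofRealHom : ℝ →+* v.Completion :=
  if hv : v.IsReal then (ringEquivRealOfIsReal hv).symm.toRingHom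
  else (ringEquivComplexOfIsComplex (isComplex_of_not_isReal v hv)).symm.toRingHom.comp
    Complex.ofRealHom

@[simp]
theorem sigma_ofRealHom (r : ℝ) : sigma v (ofRealHom v r) = r := by
  unfold ofRealHom
  split_ifs with hv
  · rw [← extensionEmbeddingOfIsReal_apply hv, ← ringEquivRealOfIsReal_apply hv]
    simp
  · exact (ringEquivComplexOfIsComplex (isComplex_of_not_isReal v hv)).apply_symm_apply (r : ℂ)

open Classical in
/-- The conjugation of `K_v`: trivial at real places, complex conjugation at complex places. -/
def conjHom : v.Completion →+* v.Completion :=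
  if hv : v.IsReal then RingHom.id _
  else (ringEquivComplexOfIsComplex (isComplex_of_not_isReal v hv)).symm.toRingHom.comp
    ((starRingEnd ℂ).comp (sigma v))

@[simp]
theorem sigma_conjHom (x : v.Completion) :
    sigma v (conjHom v x) = starRingEnd ℂ (sigma v x) := by
  unfold conjHom
  split_ifs with hv
  · exact (Complex.conj_eq_iff_im.mpr (sigma_im_of_isReal v hv x)).symm
  · exact (ringEquivComplexOfIsComplex (isComplex_of_not_isReal v hv)).apply_symm_apply
      (starRingEnd ℂ (sigma v x))

open Classical in
/-- The imaginary unit of `K_v` (zero at real places). -/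
def imUnit : v.Completion :=
  if hv : v.IsReal then 0
  else (ringEquivComplexOfIsComplex (isComplex_of_not_isReal v hv)).symm Complex.I

theorem sigma_imUnit_of_isReal (hv : v.IsReal) : sigma v (imUnit v) = 0 := by
  simp [imUnit, hv]

theorem sigma_imUnit_of_not_isReal (hv : ¬ v.IsReal) : sigma v (imUnit v) = Complex.I := by
  simp only [imUnit, hv, dif_neg, not_false_eq_true]
  exact (ringEquivComplexOfIsComplex (isComplex_of_not_isReal v hv)).apply_symm_apply Complex.I

/-- `K_v` with its own normed field structure, its conjugation and its real scalars. -/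
@[reducible]
def completionRCLike : RCLike v.Completion where
  lt_norm_lt a b ha hab := by
    refine ⟨ofRealHom v ((a + b) / 2), ?_, ?_⟩ <;>
    · rw [← norm_sigma, sigma_ofRealHom, Complex.norm_real, Real.norm_eq_abs,
        abs_of_nonneg (by linarith)]
      linarith
  star := conjHom v
  star_involutive x := sigma_injective v (by simp)
  star_mul x y := by rw [map_mul, mul_comm]
  star_add x y := map_add _ x y
  algebraMap := ofRealHom v
  smul r x := ofRealHom v r * x
  commutes' r x := mul_comm _ _
  smul_def' r x := rfl
  norm_smul_le r x := by
    change ‖ofRealHom v r * x‖ ≤ _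
    rw [norm_mul, ← norm_sigma v (ofRealHom v r), sigma_ofRealHom, Complex.norm_real]
  re := Complex.reAddGroupHom.comp (sigma v).toAddMonoidHom
  im := Complex.imAddGroupHom.comp (sigma v).toAddMonoidHom
  I := imUnit v
  I_re_ax := by
    by_cases hv : v.IsReal
    · simp [sigma_imUnit_of_isReal v hv]
    · simp [sigma_imUnit_of_not_isReal v hv]
  I_mul_I_ax := by
    by_cases hv : v.IsReal
    · left
      simp [imUnit, hv]
    · right
      apply sigma_injective v
      simp [sigma_imUnit_of_not_isReal v hv]
  re_add_im_ax z := by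
    apply sigma_injective v
    change sigma v (ofRealHom v (sigma v z).re + ofRealHom v (sigma v z).im * imUnit v) = _
    rw [map_add, map_mul, sigma_ofRealHom, sigma_ofRealHom]
    by_cases hv : v.IsReal
    · apply Complex.ext <;> simp [sigma_imUnit_of_isReal v hv, sigma_im_of_isReal v hv z]
    · rw [sigma_imUnit_of_not_isReal v hv, Complex.re_add_im]
  ofReal_re_ax r := by
    change (sigma v (ofRealHom v r)).re = r
    simp
  ofReal_im_ax r := by
    change (sigma v (ofRealHom v r)).im = 0
    simp
  mul_re_ax z w := by simp
  mul_im_ax z w := by simp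
  conj_re_ax z := by
    change (sigma v (conjHom v z)).re = (sigma v z).re
    simp
  conj_im_ax z := by
    change (sigma v (conjHom v z)).im = -(sigma v z).im
    simp
  conj_I_ax := by
    change conjHom v (imUnit v) = - imUnit v
    apply sigma_injective v
    rw [sigma_conjHom, map_neg]
    by_cases hv : v.IsReal
    · simp [sigma_imUnit_of_isReal v hv]
    · simp [sigma_imUnit_of_not_isReal v hv]
  norm_sq_eq_def_ax z := by
    change ‖z‖ ^ 2 = (sigma v z).re * (sigma v z).re + (sigma v z).im * (sigma v z).im
    rw [← norm_sigma, Complex.sq_norm, Complex.normSq_apply]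
  mul_im_I_ax z := by
    change (sigma v z).im * (sigma v (imUnit v)).im = (sigma v z).im
    by_cases hv : v.IsReal
    · simp [sigma_im_of_isReal v hv z]
    · simp [sigma_imUnit_of_not_isReal v hv]
  toPartialOrder :=
    { le := fun z w => (sigma v z).re ≤ (sigma v w).re ∧ (sigma v z).im = (sigma v w).im
      le_refl := fun z => ⟨le_rfl, rfl⟩
      le_trans := fun a b c h h' => ⟨h.1.trans h'.1, h.2.trans h'.2⟩
      le_antisymm := fun a b h h' =>
        sigma_injective v (Complex.ext (le_antisymm h.1 h'.1) h.2) }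
  le_iff_re_im := Iff.rfl
  toDecidableEq := Classical.decEq _

end Completion

/-! ### Scalar products: restriction along an injection, and tensor product -/

section ScalarProduct

variable {𝕜 : Type u} [RCLike 𝕜] {V : Type w₁} {W : Type w₂} [AddCommGroup V] [Module 𝕜 V]
  [AddCommGroup W] [Module 𝕜 W]

/-- The pull-back `⟨x, y⟩ := ⟨f x, f y⟩` of a scalar product along an injective linear map. -/
@[reducible]
def pullbackCore (c : InnerProductSpace.Core 𝕜 W) (f : V →ₗ[𝕜] W) (hf : Function.Injective f) :
    InnerProductSpace.Core 𝕜 V where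
  inner x y := c.inner (f x) (f y)
  conj_inner_symm x y := c.conj_inner_symm _ _
  re_inner_nonneg x := c.re_inner_nonneg _
  add_left x y z := by rw [map_add, c.add_left]
  smul_left x y r := by rw [map_smul, c.smul_left]
  definite x hx := hf (by rw [map_zero]; exact c.definite _ hx)

/-- The tensor product scalar product, `⟨a ⊗ b, a' ⊗ b'⟩ = ⟨a, a'⟩ ⟨b, b'⟩`
(Mathlib's inner product on a tensor product). -/
@[reducible]
def tensorCore (c : InnerProductSpace.Core 𝕜 V) (c' : InnerProductSpace.Core 𝕜 W) :
    InnerProductSpace.Core 𝕜 (V ⊗[𝕜] W) :=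
  letI := c.toNormedAddCommGroup
  letI := InnerProductSpace.ofCore c.toCore
  letI := c'.toNormedAddCommGroup
  letI := InnerProductSpace.ofCore c'.toCore
  InnerProductSpace.toCore (𝕜 := 𝕜) (E := V ⊗[𝕜] W)

theorem tensorCore_tmul (c : InnerProductSpace.Core 𝕜 V) (c' : InnerProductSpace.Core 𝕜 W)
    (a a' : V) (b b' : W) :
    (tensorCore c c').inner (a ⊗ₜ b) (a' ⊗ₜ b') = c.inner a a' * c'.inner b b' :=
  rfl

end ScalarProduct

/-! ### Arakelov bundles -/

section Bundle

variable (K : Type u) [Field K] [NumberField K]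

/-- A scalar product on a vector space over the completion `K_v` at an infinite place: euclidean if
`v` is real, hermitian if `v` is complex. -/
abbrev ScalarProduct {K : Type u} [Field K] (v : InfinitePlace K) (V : Type w₁) [AddCommGroup V]
    [Module v.Completion V] : Type (max u w₁) :=
  letI := completionRCLike v
  InnerProductSpace.Core v.Completion V

/-- An Arakelov vector bundle over the set of places of `K`: a finitely generated projective
`𝓞 K`-module `M` with a scalar product on `K_v ⊗ M` for every infinite place `v`. -/
structure Bundle where
  /-- The underlying `𝓞 K`-module. -/
  carrier : Type w₁
  [addCommGroup : AddCommGroup carrier]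
  [module : Module (𝓞 K) carrier]
  [finite : Module.Finite (𝓞 K) carrier]
  [projective : Module.Projective (𝓞 K) carrier]
  /-- The scalar products at the infinite places. -/
  metric (v : InfinitePlace K) : ScalarProduct v (v.Completion ⊗[𝓞 K] carrier)

attribute [instance] Bundle.addCommGroup Bundle.module Bundle.finite Bundle.projective

variable {K}

namespace Bundle

/-- The generic fibre `E_K = K ⊗ E`. -/
abbrev Generic (E : Bundle.{u, w₁} K) : Type (max u w₁) := K ⊗[𝓞 K] E.carrier

/-- The rank, i.e. the dimension of the generic fibre. -/
def rank (E : Bundle.{u, w₁} K) : ℕ := Module.finrank K E.Generic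

/-- The fibre `E_{K_v}` at a finite place. -/
abbrev FinFibre (E : Bundle.{u, w₁} K) (v : HeightOneSpectrum (𝓞 K)) : Type (max u w₁) :=
  v.adicCompletion K ⊗[𝓞 K] E.carrier

/-- The fibre `E_{K_v}` at an infinite place. -/
abbrev InfFibre (E : Bundle.{u, w₁} K) (v : InfinitePlace K) : Type (max u w₁) :=
  v.Completion ⊗[𝓞 K] E.carrier

/-- The canonical map `E_K → E_{K_v}` for a finite place. -/
def toFin (E : Bundle.{u, w₁} K) (v : HeightOneSpectrum (𝓞 K)) :
    E.Generic →ₗ[𝓞 K] E.FinFibre v :=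
  (IsScalarTower.toAlgHom (𝓞 K) K (v.adicCompletion K)).toLinearMap.rTensor E.carrier

/-- The canonical map `E_K → E_{K_v}` for an infinite place. -/
def toInf (E : Bundle.{u, w₁} K) (v : InfinitePlace K) : E.Generic →ₗ[𝓞 K] E.InfFibre v :=
  (IsScalarTower.toAlgHom (𝓞 K) K v.Completion).toLinearMap.rTensor E.carrier

/-- The lattice `E_{O_v}` in `E_{K_v}`, for a finite place `v`. -/
def lattice (E : Bundle.{u, w₁} K) (v : HeightOneSpectrum (𝓞 K)) :
    Submodule (v.adicCompletionIntegers K) (E.FinFibre v) :=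
  Submodule.span _ (Set.range fun m : E.carrier => (1 : v.adicCompletion K) ⊗ₜ[𝓞 K] m)

end Bundle

/-- The nonarchimedean norm attached to an `O_v`-lattice `L` in a `K_v`-vector space: the minimum of
the normalized absolute values `|a|_v` of those `a ∈ K_v` with `x ∈ a • L`. (The norm of
`v.adicCompletion K` is the normalized one, by `FinitePlace.norm_def`.) -/
def latticeNorm (v : HeightOneSpectrum (𝓞 K)) {V : Type w₁} [AddCommGroup V]
    [Module (v.adicCompletion K) V] (L : Submodule (v.adicCompletionIntegers K) V) (x : V) : ℝ :=
  sInf {r : ℝ | ∃ a : v.adicCompletion K, r = ‖a‖ ∧ ∃ y ∈ L, x = a • y}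

namespace Bundle

/-- The norm on `E_{K_v}` at a finite place. -/
def finNorm (E : Bundle.{u, w₁} K) (v : HeightOneSpectrum (𝓞 K)) (x : E.FinFibre v) : ℝ :=
  latticeNorm v (E.lattice v) x

/-- The norm on `E_{K_v}` at an infinite place: `√⟨x, x⟩` if `v` is real, and `⟨x, x⟩` if `v` is
complex. -/
def infNorm (E : Bundle.{u, w₁} K) (v : InfinitePlace K) (x : E.InfFibre v) : ℝ :=
  letI := completionRCLike v
  √(RCLike.re ((E.metric v).inner x x)) ^ v.mult

/-- The set `Γ(E)` of global sections: the generic sections whose divisor is at most one, i.e.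
whose norm is at most one at every place. -/
def globalSections (E : Bundle.{u, w₁} K) : Set E.Generic :=
  {x | (∀ v : HeightOneSpectrum (𝓞 K), E.finNorm v (E.toFin v x) ≤ 1) ∧
    ∀ v : InfinitePlace K, E.infNorm v (E.toInf v x) ≤ 1}

/-! #### Degree and slope

The degree of `E` is the degree `-log ∏_v ‖s‖_v` of the line bundle `det E`, computed with the
nonzero generic section `s = e₁ ∧ ⋯ ∧ e_r` of `det E` coming from a basis of `E_K`. -/

/-- The norm in `(det E)_{K_v} = ⋀^r E_{K_v}` of `e₁ ∧ ⋯ ∧ e_r`, for a finite place `v`. The lattice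
`(det E)_{O_v}` is generated by the `f₁ ∧ ⋯ ∧ f_r` with all `f_i ∈ E_{O_v}`. -/
def finDetNorm (E : Bundle.{u, w₁} K) (v : HeightOneSpectrum (𝓞 K)) {r : ℕ}
    (e : Fin r → E.FinFibre v) : ℝ :=
  latticeNorm v (V := ⋀[v.adicCompletion K]^r (E.FinFibre v))
    (Submodule.span _ {z | ∃ f : Fin r → E.FinFibre v,
      (∀ i, f i ∈ E.lattice v) ∧ z = exteriorPower.ιMulti (v.adicCompletion K) r f})
    (exteriorPower.ιMulti (v.adicCompletion K) r e)

/-- The norm in `(det E)_{K_v}` of `e₁ ∧ ⋯ ∧ e_r`, for an infinite place `v`. The scalar product on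
`⋀^r E_{K_v}` satisfies `⟨e₁ ∧ ⋯ ∧ e_r, e₁ ∧ ⋯ ∧ e_r⟩ = det (⟨e_i, e_j⟩)`; the norm is its square
root if `v` is real and the value itself if `v` is complex. -/
def infDetNorm (E : Bundle.{u, w₁} K) (v : InfinitePlace K) {r : ℕ}
    (e : Fin r → E.InfFibre v) : ℝ :=
  letI := completionRCLike v
  √(RCLike.re (Matrix.det (Matrix.of fun i j => (E.metric v).inner (e i) (e j)))) ^ v.mult

/-- The Arakelov degree. It does not depend on the basis, by the product formula. -/
def degree (E : Bundle.{u, w₁} K) : ℝ :=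
  let e := Module.finBasis K E.Generic;
  -Real.log ((∏ᶠ v : HeightOneSpectrum (𝓞 K), E.finDetNorm v fun i => E.toFin v (e i)) *
    ∏ v : InfinitePlace K, E.infDetNorm v fun i => E.toInf v (e i))

/-- The slope `deg E / rk E`. -/
def slope (E : Bundle.{u, w₁} K) : ℝ := E.degree / E.rank

/-! #### Subbundles and tensor products -/

theorem injective_baseChange_subtype {R : Type*} [CommRing R] (A : Type*) [CommRing A]
    [Algebra R A] {M : Type*} [AddCommGroup M] [Module R M] (p : Submodule R M)
    (hp : IsComplemented p) : Function.Injective (p.subtype.baseChange A) := by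
  obtain ⟨q, hq⟩ := hp
  have h : (p.projectionOnto q hq).comp p.subtype = LinearMap.id := by
    ext x
    simp
  refine Function.LeftInverse.injective (g := (p.projectionOnto q hq).baseChange A) fun x => ?_
  rw [← LinearMap.comp_apply, ← LinearMap.baseChange_comp, h, LinearMap.baseChange_id]
  rfl

theorem finite_of_isComplemented {R : Type*} [CommRing R] {M : Type*} [AddCommGroup M] [Module R M]
    [Module.Finite R M] (p : Submodule R M) (hp : IsComplemented p) : Module.Finite R p := by
  obtain ⟨q, hq⟩ := hp
  exact Module.Finite.of_surjective (p.projectionOnto q hq) fun x => ⟨x, by simp⟩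

theorem projective_of_isComplemented {R : Type*} [CommRing R] {M : Type*} [AddCommGroup M]
    [Module R M] [Module.Projective R M] (p : Submodule R M) (hp : IsComplemented p) :
    Module.Projective R p := by
  obtain ⟨q, hq⟩ := hp
  refine Module.Projective.of_split p.subtype (p.projectionOnto q hq) ?_
  ext x
  simp

/-- The subbundle with underlying module a direct summand `p` of `E`, with the restricted scalar
products. -/
def sub (E : Bundle.{u, w₁} K) (p : Submodule (𝓞 K) E.carrier) (hp : IsComplemented p) :
    Bundle.{u, w₁} K :=
  haveI := finite_of_isComplemented p hp
  haveI := projective_of_isComplemented p hp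
  { carrier := p
    metric := fun v =>
      letI := completionRCLike v
      pullbackCore (E.metric v) (p.subtype.baseChange v.Completion)
        (injective_baseChange_subtype v.Completion p hp) }

/-- `μ_max^{(l)}(E)`, the supremum of the slopes of the subbundles of rank `l`. -/
def maxSlope (E : Bundle.{u, w₁} K) (l : ℕ) : ℝ :=
  sSup {s : ℝ | ∃ (p : Submodule (𝓞 K) E.carrier) (hp : IsComplemented p),
    (E.sub p hp).rank = l ∧ s = (E.sub p hp).slope}

/-- The tensor product of two Arakelov bundles, with the tensor product scalar products under
`K_v ⊗ (M ⊗ N) = (K_v ⊗ M) ⊗ (K_v ⊗ N)`. -/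
def tensor (E : Bundle.{u, w₁} K) (F : Bundle.{u, w₂} K) : Bundle.{u, max w₁ w₂} K where
  carrier := E.carrier ⊗[𝓞 K] F.carrier
  metric v :=
    letI := completionRCLike v
    pullbackCore (tensorCore (E.metric v) (F.metric v))
      (TensorProduct.AlgebraTensorModule.distribBaseChange (𝓞 K) v.Completion
        E.carrier F.carrier).toLinearMap
      (LinearEquiv.injective _)

end Bundle

end Bundle

end Arakelov

end

/-! The proof is Minkowski's convex body theorem with explicit ball volumes. Let `E'` be a subbundle
of rank `l` whose slope is close to `maxSlope`. A section of `E' ⊗ F` is a section of `E ⊗ F`, so a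
nonzero section of the former suffices.

Over a Dedekind domain `E'` and `F` are direct sums of ideals `I i` and `J j`. Thus `E' ⊗ F` becomes
the lattice of vectors with entries in `I i * J j`, in a real space of dimension `d * N` with `N = l
* n`. Integrality at the finite places is automatic. At each infinite place the unit ball is the
ellipsoid of a matrix `M v ⊗ N v`, where `M v` and `N v` carry ideal coordinates to orthonormal
ones.

By `degree_eq` the degree is minus the logarithm of the ideal norms times the determinants, so the
ideal norms and determinants of `E' ⊗ F` contribute `n * deg E' + l * deg F = N * (μ(E') + μ)`.
Minkowski's inequality then becomes the hypothesis of `exists_globalSection_ne_zero_of_degree`, in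
which only the volumes of the unit balls of `ℝ ^ N` and `ℂ ^ N` remain. A Stirling bound gives their
logarithms as about `N/2 * (log π + 1 + log 2 - log N)` and `N * (log π + 1 - log N)`. With `r₁ + 2
r₂ = d` everything collects to `d/2 * (log N - log π - 1 + log 2) + log 𝔡 / 2`, the stated threshold
up to `ε`. -/

/-! ### Projective modules over Dedekind domains. -/

/-- A finite projective module over a Dedekind domain is a product of nonzero ideals. -/
theorem Module.Projective.exists_linearEquiv_pi_ideal (R : Type*) [CommRing R] [IsDedekindDomain R]
    (M : Type*) [AddCommGroup M] [Module R M] [Module.Finite R M] [Module.Projective R M] :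
    ∃ (r : ℕ) (I : Fin r → Ideal R), (∀ i, I i ≠ ⊥) ∧ Nonempty (M ≃ₗ[R] (∀ i, I i)) := by
  induction hn : Module.finrank R M using Nat.strong_induction_on generalizing M with
  | _ n ih =>
  rcases subsingleton_or_nontrivial M with hM | hM
  · exact ⟨0, fun _ => ⊤, fun i => i.elim0, ⟨0, 0, fun _ => Subsingleton.elim _ _,
      fun _ => Subsingleton.elim _ _⟩⟩
  obtain ⟨x, hx⟩ := exists_ne (0 : M)
  obtain ⟨f, hf⟩ := Module.Projective.exists_dual_ne_zero R hx
  set J : Ideal R := LinearMap.range f with hJ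
  have hJ0 : J ≠ ⊥ := fun h => hf (by
    have : f x ∈ J := ⟨x, rfl⟩
    rwa [h, Ideal.mem_bot] at this)
  -- An ideal is torsion-free, hence flat over a Dedekind domain, and being finitely presented it is
  -- projective. So `0 → ker f → M → J → 0` splits, and the induction continues with `ker f`, whose
  -- rank is smaller.
  have hJf : Module.FinitePresentation R J := Module.finitePresentation_of_finite R J
  have hJp : Module.Projective R J := Module.Flat.projective_of_finitePresentation
  obtain ⟨s, hs⟩ := Module.projective_lifting_property f.rangeRestrict
    (LinearMap.id : J →ₗ[R] J) f.surjective_rangeRestrict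
  have hs' : ∀ y : J, f (s y) = y := fun y => congrArg Subtype.val (LinearMap.congr_fun hs y)
  let F : (LinearMap.ker f × J) →ₗ[R] M := (LinearMap.ker f).subtype.coprod s
  have hF : Function.Bijective F := by
    constructor
    · rw [← LinearMap.ker_eq_bot, LinearMap.ker_eq_bot']
      rintro ⟨k, y⟩ h
      have h0 : (k : M) + s y = 0 := h
      have h1 := congrArg f h0
      rw [map_add, hs', LinearMap.mem_ker.mp k.2, zero_add, map_zero] at h1
      have hy : y = 0 := Subtype.ext h1
      rw [hy, map_zero, add_zero] at h0
      exact Prod.ext (Subtype.ext h0) hy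
    · intro z
      refine ⟨⟨⟨z - s (f.rangeRestrict z), ?_⟩, f.rangeRestrict z⟩, ?_⟩
      · rw [LinearMap.mem_ker, map_sub, hs']
        simp
      · simp [F]
  let e := LinearEquiv.ofBijective F hF
  have hfin : Module.Finite R (LinearMap.ker f) := inferInstance
  have hkfp := Module.finitePresentation_of_finite R (LinearMap.ker f)
  have hker : Module.Projective R (LinearMap.ker f) := Module.Flat.projective_of_finitePresentation
  have hJpos : 0 < Module.finrank R J := by
    rw [Module.finrank_pos_iff]
    exact Submodule.nontrivial_iff_ne_bot.mpr hJ0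
  have hrk : Module.finrank R (LinearMap.ker f) < n := by
    have h1 := Submodule.finrank_quotient_add_finrank (LinearMap.ker f)
    have h2 := (f.quotKerEquivRange).finrank_eq
    rw [h2, hn] at h1
    change Module.finrank R J + _ = _ at h1
    omega
  obtain ⟨r, I, hI, ⟨g⟩⟩ := ih _ hrk (LinearMap.ker f) rfl
  refine ⟨r + 1, Fin.cons J I, fun i => ?_, ⟨?_⟩⟩
  · refine Fin.cases hJ0 (fun j => hI j) i
  · exact e.symm.trans ((LinearEquiv.prodComm _ _ _).trans
      (((LinearEquiv.refl R J).prodCongr g).trans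
        (Fin.consLinearEquiv R (fun i => ((Fin.cons J I : Fin (r + 1) → Ideal R) i)))))

/-! ### Coordinates on fibres. -/

section Coordinates

variable {R : Type*} [CommRing R] {M : Type*} [AddCommGroup M] [Module R M] {ι : Type*}
  {I : ι → Ideal R}

/-- The coordinates of a module which is identified with a product of ideals. -/
def idealCoord (e : M ≃ₗ[R] ∀ i, I i) : M →ₗ[R] (ι → R) :=
  (LinearMap.pi fun i => (I i).subtype ∘ₗ LinearMap.proj i) ∘ₗ e.toLinearMap

theorem idealCoord_apply (e : M ≃ₗ[R] ∀ i, I i) (m : M) (i : ι) : idealCoord e m i = e m i := rfl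

theorem idealCoord_injective (e : M ≃ₗ[R] ∀ i, I i) : Function.Injective (idealCoord e) :=
  fun _ _ h => e.injective (funext fun i => Subtype.ext (congrFun h i))

theorem idealCoord_mem (e : M ≃ₗ[R] ∀ i, I i) (m : M) (i : ι) : idealCoord e m i ∈ I i :=
  (e m i).2

theorem exists_idealCoord_eq_single [DecidableEq ι] (e : M ≃ₗ[R] ∀ i, I i) (i : ι) {a : R}
    (ha : a ∈ I i) : ∃ m, idealCoord e m = Pi.single i a := by
  refine ⟨e.symm (Pi.single i ⟨a, ha⟩), funext fun j => ?_⟩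
  rw [idealCoord_apply, LinearEquiv.apply_symm_apply]
  rcases eq_or_ne j i with rfl | h
  · simp
  · simp [h]

variable [Fintype ι] [DecidableEq ι] (L : Type*) [Field L] [Algebra R L]
  [Module.Flat R L] [FaithfulSMul R L]

/-- Injectivity is flatness of `L`; surjectivity holds because a nonzero element of `I i` becomes
invertible in `L`. Over `R` itself the coordinates only embed `M` as a product of ideals. -/
theorem bijective_piScalarRight_comp_baseChange (hI : ∀ i, I i ≠ ⊥) (e : M ≃ₗ[R] ∀ i, I i) :
    Function.Bijective
      ((TensorProduct.piScalarRight R L L ι).toLinearMap ∘ₗ (idealCoord e).baseChange L) := by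
  constructor
  · exact (TensorProduct.piScalarRight R L L ι).injective.comp
      (Module.Flat.lTensor_preserves_injective_linearMap _ (idealCoord_injective e))
  · rw [← LinearMap.range_eq_top, eq_top_iff]
    rw [← (Pi.basisFun L ι).span_eq, Submodule.span_le]
    rintro _ ⟨i, rfl⟩
    obtain ⟨a, ha, ha0⟩ := Submodule.exists_mem_ne_zero_of_ne_bot (hI i)
    obtain ⟨m, hm⟩ := exists_idealCoord_eq_single e i ha
    refine ⟨(algebraMap R L a)⁻¹ ⊗ₜ m, ?_⟩
    have ha1 : algebraMap R L a ≠ 0 := by simpa using ha0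
    ext j
    rcases eq_or_ne j i with rfl | h
    · simp [hm, Algebra.smul_def, ha1]
    · simp [hm, h]

/-- The coordinates of the base change to a field of a product of nonzero ideals. -/
noncomputable def fiberCoord (hI : ∀ i, I i ≠ ⊥) (e : M ≃ₗ[R] ∀ i, I i) :
    L ⊗[R] M ≃ₗ[L] (ι → L) :=
  LinearEquiv.ofBijective
    ((TensorProduct.piScalarRight R L L ι).toLinearMap ∘ₗ (idealCoord e).baseChange L)
    (bijective_piScalarRight_comp_baseChange L hI e)

theorem fiberCoord_tmul (hI : ∀ i, I i ≠ ⊥) (e : M ≃ₗ[R] ∀ i, I i) (a : L) (m : M) (i : ι) :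
    fiberCoord L hI e (a ⊗ₜ m) i = a * algebraMap R L (idealCoord e m i) := by
  rw [fiberCoord, LinearEquiv.ofBijective_apply, LinearMap.comp_apply, LinearMap.baseChange_tmul,
    LinearEquiv.coe_coe, TensorProduct.piScalarRight_apply, TensorProduct.piScalarRightHom_tmul]
  change idealCoord e m i • a = _
  rw [Algebra.smul_def, mul_comm]

theorem finrank_tensorProduct_of_pi_ideal (hI : ∀ i, I i ≠ ⊥) (e : M ≃ₗ[R] ∀ i, I i) :
    Module.finrank L (L ⊗[R] M) = Fintype.card ι := by
  rw [(fiberCoord L hI e).finrank_eq, Module.finrank_fintype_fun_eq_card]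

end Coordinates

/-- A product of ideals has a direct summand for every initial segment of the factors. -/
theorem exists_isComplemented_linearEquiv_pi_ideal {R : Type*} [CommRing R] {M : Type*}
    [AddCommGroup M] [Module R M] {r l : ℕ} {I : Fin r → Ideal R} (e : M ≃ₗ[R] ∀ i, I i)
    (hl : l ≤ r) : ∃ p : Submodule R M, IsComplemented p ∧
      Nonempty (p ≃ₗ[R] ∀ i : Fin l, I (Fin.castLE hl i)) := by
  let π : M →ₗ[R] (∀ i : Fin l, I (Fin.castLE hl i)) :=
    (LinearMap.pi fun i => LinearMap.proj (Fin.castLE hl i)) ∘ₗ e.toLinearMap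
  let σ : (∀ i : Fin l, I (Fin.castLE hl i)) →ₗ[R] M := e.symm.toLinearMap ∘ₗ
    LinearMap.pi fun j => if h : (j : ℕ) < l then LinearMap.proj (φ := fun i : Fin l =>
      I (Fin.castLE hl i)) (⟨j, h⟩ : Fin l) else 0
  have hπσ : ∀ x, π (σ x) = x := fun x => by
    ext i
    simp [π, σ]
  have hσ : Function.Injective σ := Function.LeftInverse.injective hπσ
  refine ⟨LinearMap.range σ, ⟨LinearMap.ker π, ?_⟩, ⟨(LinearEquiv.ofInjective σ hσ).symm⟩⟩
  have h : IsCompl (LinearMap.range σ) (LinearMap.ker (σ.rangeRestrict ∘ₗ π)) := by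
    refine LinearMap.isCompl_of_proj ?_
    rintro ⟨_, x, rfl⟩
    ext
    simp [hπσ]
  rwa [LinearMap.ker_comp_of_ker_eq_bot] at h
  rw [LinearMap.ker_rangeRestrict]
  exact LinearMap.ker_eq_bot.mpr hσ

/-- If `S` is unbounded, `sSup S` has the default value `0`, but then `S` contains elements above
any number. Hence slopes of subbundles need not be shown to be bounded. -/
theorem exists_mem_sSup_sub_lt {S : Set ℝ} (hS : S.Nonempty) {η : ℝ} (hη : 0 < η) :
    ∃ s ∈ S, sSup S - η < s := by
  by_cases hb : BddAbove S
  · exact exists_lt_of_lt_csSup hS (by linarith)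
  · exact not_bddAbove_iff.mp hb _

/-! ### Gamma function, ellipsoids and lattices. -/

section Volumes

open MeasureTheory

/-- An elementary upper bound of Stirling type for the Gamma function. -/
theorem Real.Gamma_add_one_le_of_lt_one {x a : ℝ} (hx : 0 < x) (ha : 0 < a) (ha' : a < 1) :
    Real.Gamma (x + 1) ≤ (x / (a * Real.exp 1)) ^ x / (1 - a) := by
  -- The function `t ^ x * exp (-a t)` attains its maximum `(x / (a e)) ^ x` at `t = x / a`. The
  -- remaining weight `exp (-(1 - a) t)` integrates to `1 / (1 - a)`.
  have hpt : ∀ t : ℝ, 0 < t → t ^ x ≤ (x / (a * Real.exp 1)) ^ x * Real.exp (a * t) := by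
    intro t ht
    rw [Real.rpow_def_of_pos ht, Real.rpow_def_of_pos (by positivity), ← Real.exp_add,
      Real.exp_le_exp, Real.log_div hx.ne' (by positivity), Real.log_mul ha.ne' (Real.exp_ne_zero _),
      Real.log_exp]
    have h := Real.log_le_sub_one_of_pos (show 0 < a * t / x by positivity)
    rw [Real.log_div (by positivity) hx.ne', Real.log_mul ha.ne' ht.ne'] at h
    have h2 := mul_le_mul_of_nonneg_left h hx.le
    have h3 : x * (a * t / x - 1) = a * t - x := by field_simp
    nlinarith
  rw [Real.Gamma_eq_integral (by positivity)]
  have hint : IntegrableOn (fun t : ℝ => Real.exp (-(1 - a) * t)) (Set.Ioi 0) :=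
    exp_neg_integrableOn_Ioi 0 (by linarith)
  calc ∫ t in Set.Ioi (0 : ℝ), Real.exp (-t) * t ^ (x + 1 - 1)
      ≤ ∫ t in Set.Ioi (0 : ℝ), (x / (a * Real.exp 1)) ^ x * Real.exp (-(1 - a) * t) := by
        refine setIntegral_mono_on (Real.GammaIntegral_convergent (by positivity))
          (hint.const_mul _) measurableSet_Ioi fun t ht => ?_
        rw [add_sub_cancel_right]
        calc Real.exp (-t) * t ^ x ≤
            Real.exp (-t) * ((x / (a * Real.exp 1)) ^ x * Real.exp (a * t)) := by
              gcongr; exact hpt t ht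
          _ = _ := by
              rw [show -(1 - a) * t = -t + a * t by ring, Real.exp_add]; ring
    _ = _ := by
        rw [integral_const_mul, integral_exp_mul_Ioi (by linarith)]
        have h1 : 1 - a ≠ 0 := by linarith
        have h2 : -(1 - a) ≠ 0 := neg_ne_zero.mpr h1
        rw [mul_zero, Real.exp_zero, neg_div_neg_eq, mul_one_div]

/-- On boxes both measures are double products, which may be taken in either order, and boxes form a
generating π-system. The exchange is needed because the lattice is organised by coordinates and the
body by places. -/
theorem MeasureTheory.volume_measurePreserving_flip (ι κ α : Type*) [Fintype ι] [Fintype κ]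
    [MeasureSpace α] [SigmaFinite (volume : Measure α)] :
    MeasurePreserving (Function.swap : (ι → κ → α) → (κ → ι → α)) := by
  have hm : Measurable (Function.swap : (ι → κ → α) → (κ → ι → α)) :=
    measurable_pi_lambda _ fun j => measurable_pi_lambda _ fun i =>
      (measurable_pi_apply j).comp (measurable_pi_apply i)
  refine ⟨hm, ?_⟩
  symm
  refine Measure.pi_eq_generateFrom (fun _ => generateFrom_pi) (fun _ => isPiSystem_pi)
    (fun _ => Measure.FiniteSpanningSetsIn.pi fun _ => volume.toFiniteSpanningSetsIn) ?_
  intro s hs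
  choose t ht hts using hs
  have hs' : ∀ j, MeasurableSet (s j) := fun j => by
    rw [← hts j]
    exact MeasurableSet.univ_pi fun i => ht j i (Set.mem_univ i)
  rw [Measure.map_apply hm (MeasurableSet.univ_pi hs')]
  have h1 : Function.swap ⁻¹' (Set.univ.pi s) =
      Set.univ.pi fun i => Set.univ.pi fun j => t j i := by
    ext x
    simp only [← hts, Set.mem_preimage, Set.mem_univ_pi, Function.swap]
    exact forall_comm
  rw [h1, volume_pi_pi]
  simp_rw [← hts, volume_pi_pi, Measure.pi_pi]
  rw [Finset.prod_comm]

section Ellipsoid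

variable {ι : Type*} [Fintype ι]

/-- The open ellipsoid of the vectors `x` with `‖A x‖ < 1` for the euclidean norm. -/
def ellipsoid {𝕜 : Type*} [RCLike 𝕜] (A : Matrix ι ι 𝕜) : Set (ι → 𝕜) :=
  {x | ∑ k, ‖A.mulVec x k‖ ^ 2 < 1}

theorem measurableSet_ellipsoid {𝕜 : Type*} [RCLike 𝕜] (A : Matrix ι ι 𝕜) :
    MeasurableSet (ellipsoid A) := by
  refine (isOpen_lt ?_ continuous_const).measurableSet
  refine continuous_finsetSum _ fun k _ => (Continuous.norm ?_).pow 2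
  exact (continuous_apply k).comp (Continuous.matrix_mulVec continuous_const continuous_id)

theorem neg_mem_ellipsoid {𝕜 : Type*} [RCLike 𝕜] {A : Matrix ι ι 𝕜} {x : ι → 𝕜}
    (hx : x ∈ ellipsoid A) : -x ∈ ellipsoid A := by
  simpa [ellipsoid, Matrix.mulVec_neg] using hx

theorem convex_ellipsoid {𝕜 : Type*} [RCLike 𝕜] (A : Matrix ι ι 𝕜) :
    Convex ℝ (ellipsoid A) := by
  let f : (ι → 𝕜) →ₗ[ℝ] EuclideanSpace 𝕜 ι :=
    ((WithLp.linearEquiv 2 𝕜 (ι → 𝕜)).symm.toLinearMap ∘ₗ A.mulVecLin).restrictScalars ℝ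
  have h : ellipsoid A = f ⁻¹' Metric.ball 0 1 := by
    ext x
    simp only [ellipsoid, Set.mem_ofPred_eq, Set.mem_preimage, mem_ball_zero_iff]
    rw [← sq_lt_one_iff₀ (norm_nonneg _), EuclideanSpace.norm_sq_eq]
    rfl
  rw [h]
  exact (convex_ball _ _).linear_preimage f

/-- The volume of the unit ball of `ℝ ^ N`. -/
noncomputable def realBallVolume (N : ℕ) : ℝ := √Real.pi ^ N / Real.Gamma (N / 2 + 1)

/-- The volume of the unit ball of `ℂ ^ N`. -/
noncomputable def complexBallVolume (N : ℕ) : ℝ := Real.pi ^ N / Real.Gamma (N + 1)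

variable [DecidableEq ι]

theorem volume_ellipsoid_real (A : Matrix ι ι ℝ) (hA : A.det ≠ 0) :
    volume (ellipsoid A) = ENNReal.ofReal (|A.det|⁻¹ * realBallVolume (Fintype.card ι)) := by
  have h : ellipsoid A = Matrix.toLin' A ⁻¹' {x : ι → ℝ | ∑ i, |x i| ^ (2 : ℝ) < 1} := by
    ext x
    simp [ellipsoid]
  rw [h, Measure.addHaar_preimage_linearMap _ (by rwa [LinearMap.det_toLin']),
    volume_sum_rpow_lt_one _ one_le_two, ← ENNReal.ofReal_mul (abs_nonneg _),
    LinearMap.det_toLin', abs_inv, realBallVolume, Real.Gamma_add_one (by norm_num),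
    Real.Gamma_one_half_eq]
  congr 4
  ring

theorem volume_ellipsoid_complex (A : Matrix ι ι ℂ) (hA : A.det ≠ 0) :
    volume (ellipsoid A) =
      ENNReal.ofReal ((‖A.det‖ ^ 2)⁻¹ * complexBallVolume (Fintype.card ι)) := by
  have h : ellipsoid A = (Matrix.toLin' A).restrictScalars ℝ ⁻¹'
      {x : ι → ℂ | ∑ i, ‖x i‖ ^ (2 : ℝ) < 1} := by
    ext x
    simp [ellipsoid]
  -- The real determinant of a complex linear map is the norm from `ℂ` to `ℝ` of its complex
  -- determinant. This accounts for the multiplicity two of complex places.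
  have hdet : LinearMap.det ((Matrix.toLin' A).restrictScalars ℝ) = ‖A.det‖ ^ 2 := by
    rw [LinearMap.det_restrictScalars, LinearMap.det_toLin', Algebra.norm_complex_apply,
      Complex.normSq_eq_norm_sq]
  rw [h, Measure.addHaar_preimage_linearMap _ (by rw [hdet]; positivity),
    Complex.volume_sum_rpow_lt_one _ one_le_two, hdet, ← ENNReal.ofReal_mul (abs_nonneg _),
    abs_inv, abs_of_nonneg (by positivity), complexBallVolume]
  congr 3
  · norm_num
  · ring_nf

end Ellipsoid

section Lattice

variable {ι : Type*} [Fintype ι]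

theorem fundamentalDomain_pi_basis {E : Type*} [NormedAddCommGroup E] [NormedSpace ℝ E]
    {κ : ι → Type*} [∀ i, Fintype (κ i)] (b : ∀ i, Module.Basis (κ i) ℝ E) :
    ZSpan.fundamentalDomain (Pi.basis b) =
      Set.univ.pi fun i => ZSpan.fundamentalDomain (b i) := by
  ext x
  simp [ZSpan.mem_fundamentalDomain, Sigma.forall]

theorem apply_mem_span_of_mem_span_pi_basis {E : Type*} [NormedAddCommGroup E] [NormedSpace ℝ E]
    {κ : ι → Type*} (b : ∀ i, Module.Basis (κ i) ℝ E) {x : ι → E}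
    (hx : x ∈ Submodule.span ℤ (Set.range (Pi.basis b))) (i : ι) :
    x i ∈ Submodule.span ℤ (Set.range (b i)) := by
  classical
  have hle : Submodule.span ℤ (Set.range (Pi.basis b)) ≤
      (Submodule.span ℤ (Set.range (b i))).comap (LinearMap.proj i) := by
    rw [Submodule.span_le]
    rintro _ ⟨⟨j, k⟩, rfl⟩
    simp only [Submodule.comap_coe, Set.mem_preimage, LinearMap.proj_apply, SetLike.mem_coe,
      Pi.basis_apply]
    rcases eq_or_ne i j with rfl | h
    · rw [Pi.single_eq_same]
      exact Submodule.subset_span (Set.mem_range_self k)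
    · simp [h]
  exact hle hx

end Lattice

end Volumes

noncomputable section

namespace Arakelov

/-! ### Minkowski's theorem for sums of ideals. -/

section Body

open MeasureTheory mixedEmbedding

variable {K : Type u} [Field K] {ι : Type*} [Fintype ι]

/-- The product over the infinite places of the ellipsoids of given matrices. -/
def ellipsoidBody (A : {w : InfinitePlace K // w.IsReal} → Matrix ι ι ℝ)
    (B : {w : InfinitePlace K // w.IsComplex} → Matrix ι ι ℂ) : Set (ι → mixedSpace K) :=
  {x | (∀ w, (fun i => (x i).1 w) ∈ ellipsoid (A w)) ∧
    ∀ w, (fun i => (x i).2 w) ∈ ellipsoid (B w)}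

variable (A : {w : InfinitePlace K // w.IsReal} → Matrix ι ι ℝ)
    (B : {w : InfinitePlace K // w.IsComplex} → Matrix ι ι ℂ)

theorem neg_mem_ellipsoidBody {x : ι → mixedSpace K} (hx : x ∈ ellipsoidBody A B) :
    -x ∈ ellipsoidBody A B :=
  ⟨fun w => neg_mem_ellipsoid (hx.1 w), fun w => neg_mem_ellipsoid (hx.2 w)⟩

theorem convex_ellipsoidBody : Convex ℝ (ellipsoidBody A B) := by
  intro x hx y hy a b ha hb hab
  exact ⟨fun w => convex_ellipsoid (A w) (hx.1 w) (hy.1 w) ha hb hab,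
    fun w => convex_ellipsoid (B w) (hx.2 w) (hy.2 w) ha hb hab⟩

open scoped Classical in
theorem volume_ellipsoidBody [NumberField K] : volume (ellipsoidBody A B) =
    (∏ w, volume (ellipsoid (A w))) * ∏ w, volume (ellipsoid (B w)) := by
  let X := {w : InfinitePlace K // w.IsReal} → ℝ
  let Y := {w : InfinitePlace K // w.IsComplex} → ℂ
  have h1 := volume_measurePreserving_arrowProdEquivProdArrow X Y ι
  have h2 := (volume_measurePreserving_flip ι {w : InfinitePlace K // w.IsReal} ℝ).prod
    (volume_measurePreserving_flip ι {w : InfinitePlace K // w.IsComplex} ℂ)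
  have h3 := h2.comp h1
  have h4 : ellipsoidBody A B = (Prod.map Function.swap Function.swap ∘
      MeasurableEquiv.arrowProdEquivProdArrow X Y ι) ⁻¹'
      ((Set.univ.pi fun w => ellipsoid (A w)) ×ˢ (Set.univ.pi fun w => ellipsoid (B w))) := by
    ext x
    simp only [Set.mem_preimage, Set.mem_prod, Set.mem_univ_pi]
    rfl
  rw [h4]
  refine (h3.measure_preimage (((MeasurableSet.univ_pi fun w => measurableSet_ellipsoid _).prod
    (MeasurableSet.univ_pi fun w => measurableSet_ellipsoid _)).nullMeasurableSet)).trans ?_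
  rw [Measure.prod_prod, volume_pi_pi, volume_pi_pi]

open scoped Classical in
/-- Minkowski's theorem for a direct sum of ideals and a product of ellipsoids. -/
theorem exists_ne_zero_mem_ideal_mem_ellipsoidBody [NumberField K] (I : ι → Ideal (𝓞 K))
    (hI : ∀ i, I i ≠ ⊥) (h : ENNReal.ofReal ((∏ i, (Ideal.absNorm (I i) : ℝ)) *
      ((2⁻¹) ^ InfinitePlace.nrComplexPlaces K * √|(discr K : ℝ)|) ^ Fintype.card ι *
      2 ^ (Module.finrank ℚ K * Fintype.card ι)) < volume (ellipsoidBody A B)) :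
    ∃ x : ι → 𝓞 K, x ≠ 0 ∧ (∀ i, x i ∈ I i) ∧
      (fun i => mixedEmbedding K (x i)) ∈ ellipsoidBody A B := by
  let J : ι → (FractionalIdeal (nonZeroDivisors (𝓞 K)) K)ˣ := fun i =>
    FractionalIdeal.mk0 K ⟨I i, mem_nonZeroDivisors_iff_ne_zero.mpr (hI i)⟩
  have : BorelSpace (mixedSpace K) := inferInstance
  have : SecondCountableTopology (mixedSpace K) := inferInstance
  have : BorelSpace (ι → mixedSpace K) := inferInstance
  have : (volume : Measure (mixedSpace K)).IsAddHaarMeasure := inferInstance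
  have : MeasurableAdd (mixedSpace K) := inferInstance
  have : (volume : Measure (ι → mixedSpace K)).IsAddHaarMeasure :=
    Measure.pi.isAddHaarMeasure (fun _ : ι => (volume : Measure (mixedSpace K)))
  let b := fun i => fractionalIdealLatticeBasis K (J i)
  have hfund := ZSpan.isAddFundamentalDomain' (Pi.basis b) volume
  have : Countable (Submodule.span ℤ (Set.range (Pi.basis b))).toAddSubgroup := by
    change Countable (Submodule.span ℤ (Set.range (Pi.basis b)))
    infer_instance
  -- The mixed space carries Lebesgue measure on each factor `ℂ`, whence the power of `1/2` in the
  -- covolume.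
  have hvol : ∀ i, volume (ZSpan.fundamentalDomain (b i)) = ENNReal.ofReal
      ((Ideal.absNorm (I i) : ℝ) * ((2⁻¹) ^ InfinitePlace.nrComplexPlaces K *
        √|(discr K : ℝ)|)) := by
    intro i
    rw [volume_fundamentalDomain_fractionalIdealLatticeBasis,
      volume_fundamentalDomain_latticeBasis, ENNReal.ofReal_mul (by positivity),
      ENNReal.ofReal_mul (by positivity), FractionalIdeal.coe_mk0,
      FractionalIdeal.coeIdeal_absNorm, ENNReal.ofReal_pow (by positivity),
      ENNReal.ofReal_inv_of_pos two_pos, ENNReal.ofReal_ofNat]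
    congr 2
    rw [← ENNReal.ofReal_coe_nnreal]
    simp [Int.norm_eq_abs]
  obtain ⟨⟨x, hx⟩, hx0, hxb⟩ := exists_ne_zero_mem_lattice_of_measure_mul_two_pow_lt_measure hfund
    (fun x => neg_mem_ellipsoidBody A B) (convex_ellipsoidBody A B) (by
      refine lt_of_eq_of_lt ?_ h
      rw [fundamentalDomain_pi_basis, volume_pi_pi, Finset.prod_congr rfl fun i _ => hvol i,
        ← ENNReal.ofReal_prod_of_nonneg fun i _ => by positivity, Finset.prod_mul_distrib,
        Finset.prod_const, Finset.card_univ, ENNReal.ofReal_mul (by positivity) (q := 2 ^ _),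
        ENNReal.ofReal_pow (by positivity), ENNReal.ofReal_ofNat, Module.finrank_pi_fintype,
        Finset.sum_const, mixedEmbedding.finrank, smul_eq_mul, Finset.card_univ,
        mul_comm (Fintype.card ι)])
  have hxi := fun i => apply_mem_span_of_mem_span_pi_basis b hx i
  simp only [b, mem_span_fractionalIdealLatticeBasis] at hxi
  have hxi' : ∀ i, ∃ y ∈ I i, mixedEmbedding K (y : K) = x i := by
    intro i
    obtain ⟨z, hz, hzx⟩ := hxi i
    obtain ⟨y, hy, rfl⟩ := (FractionalIdeal.mem_coeIdeal _).mp hz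
    exact ⟨y, hy, hzx⟩
  choose y hy hyx using hxi'
  refine ⟨y, ?_, hy, ?_⟩
  · rintro rfl
    refine hx0 (Subtype.ext (funext fun i => ?_))
    simp [← hyx i]
  · simp only [hyx]
    exact hxb

theorem norm_extensionEmbeddingOfIsReal {v : InfinitePlace K} (hv : v.IsReal)
    (x : v.Completion) :
    ‖InfinitePlace.Completion.extensionEmbeddingOfIsReal hv x‖ = ‖x‖ :=
  (InfinitePlace.Completion.isometry_extensionEmbeddingOfIsReal hv).norm_map_of_map_zero
    (map_zero _) x

/-- Minkowski's theorem for a direct sum of ideals, in terms of the infinite completions. -/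
theorem exists_ne_zero_mem_ideal_sum_norm_sq_lt_one [NumberField K] [DecidableEq ι]
    (I : ι → Ideal (𝓞 K)) (hI : ∀ i, I i ≠ ⊥)
    (M : ∀ v : InfinitePlace K, Matrix ι ι v.Completion) (hM : ∀ v, (M v).det ≠ 0)
    (h : (∏ i, (Ideal.absNorm (I i) : ℝ)) *
      ((2⁻¹) ^ InfinitePlace.nrComplexPlaces K * √|(discr K : ℝ)|) ^ Fintype.card ι *
      2 ^ (Module.finrank ℚ K * Fintype.card ι) <
      realBallVolume (Fintype.card ι) ^ InfinitePlace.nrRealPlaces K *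
      complexBallVolume (Fintype.card ι) ^ InfinitePlace.nrComplexPlaces K *
      ∏ v, (‖(M v).det‖ ^ v.mult)⁻¹) :
    ∃ x : ι → 𝓞 K, x ≠ 0 ∧ (∀ i, x i ∈ I i) ∧
      ∀ v, ∑ k, ‖(M v).mulVec (fun i => algebraMap (𝓞 K) v.Completion (x i)) k‖ ^ 2 < 1 := by
  classical
  let A : ∀ w : {w : InfinitePlace K // w.IsReal}, Matrix ι ι ℝ := fun w =>
    (InfinitePlace.Completion.extensionEmbeddingOfIsReal w.2).mapMatrix (M w)
  let B : ∀ w : {w : InfinitePlace K // w.IsComplex}, Matrix ι ι ℂ := fun w =>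
    (sigma w.1).mapMatrix (M w)
  have hA : ∀ w, |(A w).det| = ‖(M w).det‖ := fun w => by
    rw [← RingHom.map_det, ← Real.norm_eq_abs, norm_extensionEmbeddingOfIsReal]
  have hB : ∀ w, ‖(B w).det‖ = ‖(M w).det‖ := fun w => by
    rw [← RingHom.map_det, norm_sigma]
  have hR : 0 < realBallVolume (Fintype.card ι) :=
    div_pos (pow_pos (Real.sqrt_pos.mpr Real.pi_pos) _) (Real.Gamma_pos_of_pos (by positivity))
  have hC : 0 < complexBallVolume (Fintype.card ι) :=
    div_pos (pow_pos Real.pi_pos _) (Real.Gamma_pos_of_pos (by positivity))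
  have hvA : ∀ w, volume (ellipsoid (A w)) =
      ENNReal.ofReal (‖(M w).det‖⁻¹ * realBallVolume (Fintype.card ι)) := fun w => by
    rw [volume_ellipsoid_real _ (abs_ne_zero.mp (by rw [hA]; exact norm_ne_zero_iff.mpr (hM w))),
      hA]
  have hvB : ∀ w, volume (ellipsoid (B w)) =
      ENNReal.ofReal ((‖(M w).det‖ ^ 2)⁻¹ * complexBallVolume (Fintype.card ι)) := fun w => by
    rw [volume_ellipsoid_complex _ (norm_ne_zero_iff.mp (by
      rw [hB]; exact norm_ne_zero_iff.mpr (hM w))), hB]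
  obtain ⟨x, hx0, hxI, hx⟩ := exists_ne_zero_mem_ideal_mem_ellipsoidBody A B I hI (by
    rw [volume_ellipsoidBody, Finset.prod_congr rfl fun w _ => hvA w,
      Finset.prod_congr rfl fun w _ => hvB w,
      ← ENNReal.ofReal_prod_of_nonneg fun i _ => by positivity,
      ← ENNReal.ofReal_prod_of_nonneg fun i _ => by positivity,
      ← ENNReal.ofReal_mul (Finset.prod_nonneg fun i _ => by positivity)]
    refine (ENNReal.ofReal_lt_ofReal_iff_of_nonneg (by positivity)).mpr (h.trans_eq ?_)
    rw [Finset.prod_mul_distrib, Finset.prod_mul_distrib, Finset.prod_const, Finset.prod_const,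
      Finset.card_univ, Finset.card_univ]
    have hsplit : ∏ v : InfinitePlace K, (‖(M v).det‖ ^ v.mult)⁻¹ =
        (∏ w : {w : InfinitePlace K // w.IsReal}, ‖(M w).det‖⁻¹) *
        ∏ w : {w : InfinitePlace K // w.IsComplex}, (‖(M w).det‖ ^ 2)⁻¹ := by
      rw [InfinitePlace.prod_eq_prod_mul_prod]
      congr 1
      · exact Finset.prod_congr rfl fun w _ => by rw [InfinitePlace.mult_isReal, pow_one]
      · exact Finset.prod_congr rfl fun w _ => by rw [InfinitePlace.mult_isComplex]
    rw [hsplit, InfinitePlace.nrRealPlaces, InfinitePlace.nrComplexPlaces]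
    ring)
  refine ⟨x, hx0, hxI, fun v => ?_⟩
  rcases v.isReal_or_isComplex with hv | hv
  · refine lt_of_eq_of_lt (Finset.sum_congr rfl fun k _ => ?_) (hx.1 ⟨v, hv⟩)
    rw [← norm_extensionEmbeddingOfIsReal hv, RingHom.map_mulVec]
    congr 3
    funext i
    change InfinitePlace.Completion.extensionEmbeddingOfIsReal hv ((x i : K) : v.Completion) = _
    rw [mixedEmbedding_apply_isReal]
    exact InfinitePlace.Completion.extensionEmbeddingOfIsReal_coe hv _
  · refine lt_of_eq_of_lt (Finset.sum_congr rfl fun k _ => ?_) (hx.2 ⟨v, hv⟩)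
    rw [← norm_sigma v, RingHom.map_mulVec]
    congr 3
    funext i
    change sigma v ((x i : K) : v.Completion) = _
    rw [mixedEmbedding_apply_isComplex]
    exact InfinitePlace.Completion.extensionEmbedding_coe v _

end Body

/-! ### Ideals and determinant norms at finite places. -/

section FinitePlaces

open HeightOneSpectrum

variable {K : Type u} [Field K] [NumberField K]

theorem mem_adicCompletionIntegers_iff_norm_le_one (v : HeightOneSpectrum (𝓞 K))
    {x : v.adicCompletion K} : x ∈ v.adicCompletionIntegers K ↔ ‖x‖ ≤ 1 := by
  rw [HeightOneSpectrum.mem_adicCompletionIntegers, FinitePlace.norm_def, ← NNReal.coe_one,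
    NNReal.coe_le_coe, WithZeroMulInt.toNNReal_le_one_iff (HeightOneSpectrum.one_lt_absNorm_nnreal v)]

theorem norm_algebraMap_adicCompletion (v : HeightOneSpectrum (𝓞 K)) {x : 𝓞 K} (hx : x ≠ 0) :
    ‖algebraMap (𝓞 K) (v.adicCompletion K) x‖ =
      (Ideal.absNorm (v.maxPowDividing (Ideal.span {x})) : ℝ)⁻¹ :=
  eq_inv_of_mul_eq_one_left (HeightOneSpectrum.embedding_mul_absNorm K v hx)

/-- A local generator of an ideal at a finite place. -/
theorem exists_mem_norm_eq_inv_absNorm_maxPowDividing (v : HeightOneSpectrum (𝓞 K))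
    {I : Ideal (𝓞 K)} (hI : I ≠ ⊥) :
    ∃ c ∈ I, ‖algebraMap (𝓞 K) (v.adicCompletion K) c‖ =
        (Ideal.absNorm (v.maxPowDividing I) : ℝ)⁻¹ ∧
      ∀ x ∈ I, ‖algebraMap (𝓞 K) (v.adicCompletion K) x‖ ≤
        ‖algebraMap (𝓞 K) (v.adicCompletion K) c‖ := by
  classical
  have hirr := v.associates_irreducible
  have hI0 : Associates.mk I ≠ 0 := Associates.mk_ne_zero.mpr hI
  set m := (Associates.mk v.asIdeal).count (Associates.mk I).factors with hm
  have hN : 1 < Ideal.absNorm v.asIdeal := by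
    exact_mod_cast HeightOneSpectrum.one_lt_absNorm_nnreal v
  have hcount : ∀ (J : Ideal (𝓞 K)), J ≠ ⊥ → ∀ k : ℕ, J ≤ v.asIdeal ^ k ↔
      k ≤ (Associates.mk v.asIdeal).count (Associates.mk J).factors := by
    intro J hJ k
    rw [← Associates.prime_pow_dvd_iff_le (Associates.mk_ne_zero.mpr hJ) hirr, ← Associates.mk_pow,
      Associates.mk_le_mk_iff_dvd, Ideal.dvd_iff_le]
  -- As `m` is the exact exponent of `v` in `I`, some `c ∈ I` avoids `v ^ (m + 1)`. It has valuation
  -- exactly `m`, the least possible on `I`.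
  have hnot : ¬ I ≤ v.asIdeal ^ (m + 1) := by
    rw [hcount I hI]
    omega
  obtain ⟨c, hcI, hc⟩ := Set.not_subset.mp hnot
  have hspan : ∀ x ∈ I, x ≠ 0 →
      m ≤ (Associates.mk v.asIdeal).count (Associates.mk (Ideal.span {x})).factors := by
    intro x hx hx0
    rw [← hcount _ (by simpa using hx0), Ideal.span_singleton_le_iff_mem]
    exact ((hcount I hI m).mpr le_rfl) hx
  have hc0 : c ≠ 0 := by
    rintro rfl
    exact hc (zero_mem _)
  have hcm : (Associates.mk v.asIdeal).count (Associates.mk (Ideal.span {c})).factors = m := by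
    refine le_antisymm ?_ (hspan c hcI hc0)
    by_contra! h
    have h1 : m + 1 ≤ _ := h
    rw [← hcount _ (by simpa using hc0), Ideal.span_singleton_le_iff_mem] at h1
    exact hc h1
  have hceq : ‖algebraMap (𝓞 K) (v.adicCompletion K) c‖ =
        (Ideal.absNorm (v.maxPowDividing I) : ℝ)⁻¹ := by
    rw [norm_algebraMap_adicCompletion v hc0, maxPowDividing, maxPowDividing, hcm]
  refine ⟨c, hcI, hceq, fun x hx => ?_⟩
  rcases eq_or_ne x 0 with rfl | hx0
  · simp
  · rw [hceq, norm_algebraMap_adicCompletion v hx0, maxPowDividing, maxPowDividing, map_pow,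
      map_pow, Nat.cast_pow, Nat.cast_pow]
    have h1 : (1 : ℝ) ≤ Ideal.absNorm v.asIdeal := by exact_mod_cast hN.le
    exact inv_anti₀ (by positivity) (pow_le_pow_right₀ h1 (hspan x hx hx0))

theorem hasFiniteMulSupport_absNorm_maxPowDividing {I : Ideal (𝓞 K)} (hI : I ≠ ⊥) :
    Function.HasFiniteMulSupport
      fun v : HeightOneSpectrum (𝓞 K) => (Ideal.absNorm (v.maxPowDividing I) : ℝ) := by
  refine Set.Finite.subset (Ideal.hasFiniteMulSupport hI) fun v hv h => hv ?_
  simp only [h, map_one, Nat.cast_one]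

theorem finprod_absNorm_maxPowDividing {I : Ideal (𝓞 K)} (hI : I ≠ ⊥) :
    ∏ᶠ v : HeightOneSpectrum (𝓞 K), (Ideal.absNorm (v.maxPowDividing I) : ℝ) =
      Ideal.absNorm I := by
  conv_rhs => rw [← Ideal.finprod_heightOneSpectrum_factorization hI]
  exact (((Nat.castRingHom ℝ).toMonoidHom.comp Ideal.absNorm.toMonoidHom).map_finprod_of_preimage_one
      (by simp) _).symm

end FinitePlaces

section Coordinates

/-- Coordinates commute with `K → K_v`. Hence in `degree_eq` the coordinate determinants at all
places come from a single element of `K`. -/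
theorem fiberCoord_rTensor {R : Type*} [CommRing R] {M : Type*} [AddCommGroup M] [Module R M]
    {ι : Type*} {I : ι → Ideal R} [Fintype ι] [DecidableEq ι] (K L : Type*) [Field K] [Field L]
    [Algebra R K] [Algebra R L] [Algebra K L] [IsScalarTower R K L]
    [Module.Flat R K] [FaithfulSMul R K] [Module.Flat R L] [FaithfulSMul R L]
    (hI : ∀ i, I i ≠ ⊥) (e : M ≃ₗ[R] ∀ i, I i) (x : K ⊗[R] M) (i : ι) :
    fiberCoord L hI e ((IsScalarTower.toAlgHom R K L).toLinearMap.rTensor M x) i =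
      algebraMap K L (fiberCoord K hI e x i) := by
  induction x with
  | zero => simp
  | add x y hx hy => simp only [map_add, Pi.add_apply, hx, hy]
  | tmul a m =>
    rw [LinearMap.rTensor_tmul, fiberCoord_tmul, fiberCoord_tmul, map_mul,
      ← IsScalarTower.algebraMap_apply]
    rfl

end Coordinates

/-- Alternating maps in top degree factor through the determinant. -/
theorem alternatingMap_eq_det_smul {R M N : Type*} [CommRing R] [AddCommGroup M] [Module R M]
    [AddCommGroup N] [Module R N] {ι : Type*} [Fintype ι] [DecidableEq ι]
    (b : Module.Basis ι R M) (f : M [⋀^ι]→ₗ[R] N) (x : ι → M) : f x = b.det x • f b := by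
  have h : f = (LinearMap.toSpanSingleton R N (f b)).compAlternatingMap b.det := by
    refine Module.Basis.ext_alternating b fun σ hσ => ?_
    let τ : Equiv.Perm ι := Equiv.ofBijective σ (Finite.injective_iff_bijective.mp hσ)
    have h1 := f.map_perm b τ
    have h2 := b.det.map_perm b τ
    have h3 : (fun i => b (σ i)) = b ∘ τ := rfl
    rw [h3, LinearMap.compAlternatingMap_apply, h1, h2, b.det_self,
      LinearMap.toSpanSingleton_apply]
    simp
  exact DFunLike.congr_fun h x

section FinDetNorm

variable {K : Type u} [Field K] [NumberField K] (E : Bundle.{u, w₁} K)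
  {r : ℕ} {I : Fin r → Ideal (𝓞 K)} (hI : ∀ i, I i ≠ ⊥) (e : E.carrier ≃ₗ[𝓞 K] ∀ i, I i)
  (v : HeightOneSpectrum (𝓞 K))

/-- Each `c i` generates `I i` locally, so in coordinates the lattice lies in the product of the `c
i * O_v`. -/
theorem exists_mul_eq_fiberCoord_of_mem_lattice {c : Fin r → 𝓞 K}
    (hc0 : ∀ i, c i ≠ 0)
    (hc : ∀ i, ∀ x ∈ I i, ‖algebraMap (𝓞 K) (v.adicCompletion K) x‖ ≤
        ‖algebraMap (𝓞 K) (v.adicCompletion K) (c i)‖) {g : E.FinFibre v}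
    (hg : g ∈ E.lattice v) (i : Fin r) : ∃ y ∈ v.adicCompletionIntegers K,
      fiberCoord (v.adicCompletion K) hI e g i =
        algebraMap (𝓞 K) (v.adicCompletion K) (c i) * y := by
  have hci : algebraMap (𝓞 K) (v.adicCompletion K) (c i) ≠ 0 := by simpa using hc0 i
  induction hg using Submodule.span_induction with
  | mem x hx =>
    obtain ⟨m, rfl⟩ := hx
    refine ⟨(algebraMap (𝓞 K) (v.adicCompletion K) (c i))⁻¹ *
      algebraMap (𝓞 K) (v.adicCompletion K) (idealCoord e m i), ?_, ?_⟩
    · rw [mem_adicCompletionIntegers_iff_norm_le_one, norm_mul, norm_inv]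
      exact inv_mul_le_one_of_le₀ (hc i _ (idealCoord_mem e m i)) (norm_nonneg _)
    · rw [fiberCoord_tmul, one_mul, mul_inv_cancel_left₀ hci]
  | zero => exact ⟨0, zero_mem _, by simp⟩
  | add x y _ _ hx hy =>
    obtain ⟨a, ha, ha'⟩ := hx
    obtain ⟨b, hb, hb'⟩ := hy
    exact ⟨a + b, add_mem ha hb, by rw [map_add, Pi.add_apply, ha', hb', mul_add]⟩
  | smul a x _ hx =>
    obtain ⟨b, hb, hb'⟩ := hx
    refine ⟨a * b, mul_mem a.2 hb, ?_⟩
    have : a • x = (a : v.adicCompletion K) • x := rfl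
    rw [this, map_smul, Pi.smul_apply, hb', smul_eq_mul]
    ring

/-- The top exterior power is a line on which `b.det` is a coordinate. There the lattice becomes `C
* O_v` with `C` the product of local generators of the ideals, so the norm is `‖det‖ / ‖C‖`. -/
theorem finDetNorm_eq (f : Fin r → E.FinFibre v) : E.finDetNorm v f =
    ‖(Matrix.of fun i j => fiberCoord (v.adicCompletion K) hI e (f j) i).det‖ *
      ∏ i, (Ideal.absNorm (v.maxPowDividing (I i)) : ℝ) := by
  choose c hcI hcn hcmax using fun i => exists_mem_norm_eq_inv_absNorm_maxPowDividing v (hI i)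
  have hpos : ∀ i, 0 < ‖algebraMap (𝓞 K) (v.adicCompletion K) (c i)‖ := fun i => by
    rw [hcn]
    refine inv_pos.mpr (Nat.cast_pos.mpr (Nat.pos_of_ne_zero ?_))
    rw [ne_eq, Ideal.absNorm_eq_zero_iff]
    exact pow_ne_zero _ v.ne_bot
  have hc0 : ∀ i, c i ≠ 0 := fun i h => by simpa [h] using hpos i
  let b : Module.Basis (Fin r) (v.adicCompletion K) (E.FinFibre v) :=
    Module.Basis.ofEquivFun (fiberCoord (v.adicCompletion K) hI e)
  have hb : ∀ g : Fin r → E.FinFibre v,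
      b.det g = (Matrix.of fun i j => fiberCoord (v.adicCompletion K) hI e (g j) i).det :=
    fun g => rfl
  set C : v.adicCompletion K := ∏ i, algebraMap (𝓞 K) (v.adicCompletion K) (c i) with hC
  have hCnorm : ‖C‖ = (∏ i, (Ideal.absNorm (v.maxPowDividing (I i)) : ℝ))⁻¹ := by
    rw [hC, norm_prod, ← Finset.prod_inv_distrib]
    exact Finset.prod_congr rfl fun i _ => hcn i
  have hC0 : C ≠ 0 := by
    rw [hC, Finset.prod_ne_zero_iff]
    exact fun i _ => norm_pos_iff.mp (hpos i)
  rw [← hb, ← inv_inv (∏ i, _), ← hCnorm, Bundle.finDetNorm, latticeNorm]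
  refine IsLeast.csInf_eq ⟨?_, ?_⟩
  -- The minimum is attained at `a = b.det f / C`, using the wedge of vectors `1 ⊗ m i` whose only
  -- nonzero coordinate is `c i`.
  · choose m hm using fun i => exists_idealCoord_eq_single e i (hcI i)
    refine ⟨b.det f * C⁻¹, by rw [norm_mul, norm_inv], exteriorPower.ιMulti (v.adicCompletion K) r
      fun i => (1 : v.adicCompletion K) ⊗ₜ[𝓞 K] m i, Submodule.subset_span ⟨_, fun i =>
        Submodule.subset_span ⟨m i, rfl⟩, rfl⟩, ?_⟩
    have h1 : b.det (fun i => (1 : v.adicCompletion K) ⊗ₜ[𝓞 K] m i) = C := by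
      rw [hb]
      have : (Matrix.of fun i j => fiberCoord (v.adicCompletion K) hI e
          ((1 : v.adicCompletion K) ⊗ₜ[𝓞 K] m j) i) =
          Matrix.diagonal fun i => algebraMap (𝓞 K) (v.adicCompletion K) (c i) := by
        ext i j
        rw [Matrix.of_apply, fiberCoord_tmul, hm, one_mul]
        rcases eq_or_ne i j with rfl | h
        · simp
        · simp [h]
      rw [this, Matrix.det_diagonal]
    rw [alternatingMap_eq_det_smul b _ f, alternatingMap_eq_det_smul b _ (fun i => _ ⊗ₜ _), h1,
      smul_smul, inv_mul_cancel_right₀ hC0]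
  · rintro _ ⟨a, rfl, y, hy, hya⟩
    -- Conversely, `Δ` maps the lattice into `C * O_v`, since each column of coordinates is
    -- divisible by the `c i` row by row; this bounds every admissible `‖a‖` from below.
    let Δ := exteriorPower.alternatingMapLinearEquiv b.det
    have hΔ : ∀ y ∈ (Submodule.span (v.adicCompletionIntegers K)
        {z | ∃ f : Fin r → E.FinFibre v, (∀ i, f i ∈ E.lattice v) ∧
          z = exteriorPower.ιMulti (v.adicCompletion K) r f}),
        ∃ o ∈ v.adicCompletionIntegers K, Δ y = C * o := by
      intro y hy
      induction hy using Submodule.span_induction with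
      | mem x hx =>
        obtain ⟨g, hg, rfl⟩ := hx
        choose o ho hog using fun i j =>
          exists_mul_eq_fiberCoord_of_mem_lattice E hI e v hc0 hcmax (hg j) i
        let N : Matrix (Fin r) (Fin r) (v.adicCompletionIntegers K) :=
          Matrix.of fun i j => ⟨o i j, ho i j⟩
        refine ⟨(N.det : v.adicCompletion K), N.det.2, ?_⟩
        have h1 : (N.det : v.adicCompletion K) = (Matrix.of o).det :=
          RingHom.map_det (v.adicCompletionIntegers K).subtype N
        rw [exteriorPower.alternatingMapLinearEquiv_apply_ιMulti, hb, h1, ← Matrix.det_mul_column]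
        congr 1
        exact Matrix.ext fun i j => hog i j
      | zero => exact ⟨0, zero_mem _, by simp⟩
      | add x y _ _ hx hy =>
        obtain ⟨a, ha, ha'⟩ := hx
        obtain ⟨b, hb, hb'⟩ := hy
        exact ⟨a + b, add_mem ha hb, by rw [map_add, ha', hb', mul_add]⟩
      | smul a x _ hx =>
        obtain ⟨b, hb, hb'⟩ := hx
        refine ⟨a * b, mul_mem a.2 hb, ?_⟩
        refine (map_smul Δ (a : v.adicCompletion K) x).trans ?_
        rw [hb', smul_eq_mul]
        ring
    obtain ⟨o, ho, hyo⟩ := hΔ y hy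
    have h2 := congrArg Δ hya
    rw [exteriorPower.alternatingMapLinearEquiv_apply_ιMulti, map_smul, hyo, smul_eq_mul] at h2
    rw [h2, norm_mul, norm_mul, mul_assoc, mul_comm ‖C‖, mul_inv_cancel_right₀
      (norm_ne_zero_iff.mpr hC0)]
    exact mul_le_of_le_one_right (norm_nonneg _)
      ((mem_adicCompletionIntegers_iff_norm_le_one v).mp ho)

end FinDetNorm

/-! ### Scalar products in orthonormal coordinates. -/

section ScalarProducts

variable {𝕜 : Type*} [RCLike 𝕜] {V W : Type*} [AddCommGroup V] [Module 𝕜 V]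
  [AddCommGroup W] [Module 𝕜 W]

/-- Orthonormal coordinates for a scalar product. -/
theorem exists_linearEquiv_inner_eq_sum {ι : Type*} [Fintype ι] (c : InnerProductSpace.Core 𝕜 V)
    (e : V ≃ₗ[𝕜] (ι → 𝕜)) : ∃ T : V ≃ₗ[𝕜] (ι → 𝕜),
      ∀ x y, c.inner x y = ∑ k, starRingEnd 𝕜 (T x k) * T y k := by
  let := c.toNormedAddCommGroup
  let := InnerProductSpace.ofCore c.toCore
  have : FiniteDimensional 𝕜 V := Module.Finite.equiv e.symm
  have hcard : Module.finrank 𝕜 V = Fintype.card ι := by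
    rw [e.finrank_eq, Module.finrank_fintype_fun_eq_card]
  let b : OrthonormalBasis ι 𝕜 V := (stdOrthonormalBasis 𝕜 V).reindex
    (Fintype.equivOfCardEq (by rw [Fintype.card_fin, hcard]))
  refine ⟨b.repr.toLinearEquiv.trans (WithLp.linearEquiv 2 𝕜 (ι → 𝕜)), fun x y => ?_⟩
  have h1 : c.inner x y = inner 𝕜 (b.repr x) (b.repr y) := (b.repr.inner_map_map x y).symm
  rw [h1, PiLp.inner_apply]
  exact Finset.sum_congr rfl fun k _ => mul_comm _ _

theorem re_det_conj_mul {ι : Type*} [Fintype ι] [DecidableEq ι] (N : Matrix ι ι 𝕜) :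
    RCLike.re (Matrix.of fun i j => ∑ k, starRingEnd 𝕜 (N k i) * N k j).det = ‖N.det‖ ^ 2 := by
  have h : (Matrix.of fun i j => ∑ k, starRingEnd 𝕜 (N k i) * N k j) = N.conjTranspose * N := by
    ext i j
    rfl
  rw [h, Matrix.det_mul, Matrix.det_conjTranspose, RCLike.star_def, RCLike.conj_mul]
  norm_cast

theorem re_sum_conj_mul_self {ι : Type*} [Fintype ι] (u : ι → 𝕜) :
    RCLike.re (∑ k, starRingEnd 𝕜 (u k) * u k) = ∑ k, ‖u k‖ ^ 2 := by
  rw [map_sum]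
  refine Finset.sum_congr rfl fun k _ => ?_
  rw [RCLike.conj_mul]
  norm_cast

theorem exists_matrix_inner_eq_sum {ι : Type*} [Fintype ι] [DecidableEq ι]
    (c : InnerProductSpace.Core 𝕜 V) (e : V ≃ₗ[𝕜] (ι → 𝕜)) : ∃ M : Matrix ι ι 𝕜, M.det ≠ 0 ∧
      ∀ x y, c.inner x y = ∑ k, starRingEnd 𝕜 (M.mulVec (e x) k) * M.mulVec (e y) k := by
  obtain ⟨T, hT⟩ := exists_linearEquiv_inner_eq_sum c e
  have hM : ∀ x, (LinearMap.toMatrix' (e.symm.trans T).toLinearMap).mulVec (e x) = T x := by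
    intro x
    rw [LinearMap.toMatrix'_mulVec]
    simp
  refine ⟨LinearMap.toMatrix' (e.symm.trans T).toLinearMap, ?_, fun x y => ?_⟩
  · rw [LinearMap.det_toMatrix']
    exact (LinearEquiv.isUnit_det' _).ne_zero
  · rw [hT, hM, hM]

/-- If `F` is the matrix with the coordinates of the `f j` as columns, the Gram matrix is `(M * F)ᴴ
* (M * F)`. -/
theorem re_det_inner_eq {ι : Type*} [Fintype ι] [DecidableEq ι]
    (c : InnerProductSpace.Core 𝕜 V) (e : V ≃ₗ[𝕜] (ι → 𝕜)) {M : Matrix ι ι 𝕜}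
    (hM : ∀ x y, c.inner x y = ∑ k, starRingEnd 𝕜 (M.mulVec (e x) k) * M.mulVec (e y) k)
    (f : ι → V) : RCLike.re (Matrix.of fun i j => c.inner (f i) (f j)).det =
      (‖M.det‖ * ‖(Matrix.of fun i j => e (f j) i).det‖) ^ 2 := by
  rw [← norm_mul, ← Matrix.det_mul, ← re_det_conj_mul]
  simp only [hM]
  rfl

end ScalarProducts

section TensorCoord

variable {R : Type*} [CommRing R] {V W : Type*} [AddCommGroup V] [Module R V]
  [AddCommGroup W] [Module R W] {ι κ : Type*}

/-- The products of the coordinates on two modules, as coordinates on the tensor product. -/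
def tensorCoord (T : V →ₗ[R] (ι → R)) (T' : W →ₗ[R] (κ → R)) : V ⊗[R] W →ₗ[R] (ι × κ → R) :=
  TensorProduct.lift <| LinearMap.mk₂ R (fun a b k => T a k.1 * T' b k.2)
    (fun a a' b => by ext; simp [add_mul]) (fun r a b => by ext; simp [mul_assoc])
    (fun a b b' => by ext; simp [mul_add]) (fun r a b => by ext; simp [mul_left_comm])

theorem tensorCoord_tmul (T : V →ₗ[R] (ι → R)) (T' : W →ₗ[R] (κ → R)) (a : V) (b : W)
    (k : ι × κ) : tensorCoord T T' (a ⊗ₜ b) k = T a k.1 * T' b k.2 := rfl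

/-- The scalar product on a tensor product in terms of orthonormal coordinates. -/
theorem tensorCore_inner_map_eq_sum {𝕜 : Type*} [RCLike 𝕜] {V W V₀ W₀ : Type*} [AddCommGroup V]
    [Module 𝕜 V] [AddCommGroup W] [Module 𝕜 W] [AddCommGroup V₀] [Module 𝕜 V₀] [AddCommGroup W₀]
    [Module 𝕜 W₀] [Fintype ι] [Fintype κ] (c : InnerProductSpace.Core 𝕜 V)
    (c' : InnerProductSpace.Core 𝕜 W) (f : V₀ →ₗ[𝕜] V) (g : W₀ →ₗ[𝕜] W)
    (T : V₀ →ₗ[𝕜] (ι → 𝕜)) (T' : W₀ →ₗ[𝕜] (κ → 𝕜))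
    (hT : ∀ x y, c.inner (f x) (f y) = ∑ k, starRingEnd 𝕜 (T x k) * T y k)
    (hT' : ∀ x y, c'.inner (g x) (g y) = ∑ k, starRingEnd 𝕜 (T' x k) * T' y k)
    (z z' : V₀ ⊗[𝕜] W₀) :
    (tensorCore c c').inner (TensorProduct.map f g z) (TensorProduct.map f g z') =
      ∑ k, starRingEnd 𝕜 (tensorCoord T T' z k) * tensorCoord T T' z' k := by
  let := (tensorCore c c').toNormedAddCommGroup
  let := InnerProductSpace.ofCore (tensorCore c c').toCore
  change inner 𝕜 (TensorProduct.map f g z) (TensorProduct.map f g z') = _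
  induction z with
  | zero => simp
  | add x y hx hy =>
    simp only [map_add, inner_add_left, hx, hy, Pi.add_apply, add_mul, Finset.sum_add_distrib]
  | tmul a b =>
    induction z' with
    | zero => simp
    | add x y hx hy =>
      simp only [map_add, inner_add_right, hx, hy, Pi.add_apply, mul_add, Finset.sum_add_distrib]
    | tmul a' b' =>
      simp only [TensorProduct.map_tmul]
      refine (tensorCore_tmul c c' _ _ _ _).trans ?_
      rw [hT, hT', Finset.sum_mul_sum, ← Finset.sum_product', Finset.univ_product_univ]
      refine Finset.sum_congr rfl fun k _ => ?_
      rw [tensorCoord_tmul, tensorCoord_tmul, map_mul]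
      ring

end TensorCoord

section InfDetNorm

variable {K : Type u} [Field K] [NumberField K] (E : Bundle.{u, w₁} K)
  {ι : Type*} [Fintype ι] [DecidableEq ι] {I : ι → Ideal (𝓞 K)} (hI : ∀ i, I i ≠ ⊥)
  (e : E.carrier ≃ₗ[𝓞 K] ∀ i, I i)

/-- A matrix describes the scalar product of a bundle at an infinite place, with respect to the
coordinates given by an identification with a product of ideals, if it maps these coordinates to
orthonormal ones. -/
def IsMetricMatrix (v : InfinitePlace K) (M : Matrix ι ι v.Completion) : Prop :=
  M.det ≠ 0 ∧ ∀ x y, (E.metric v).inner x y = ∑ k,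
    conjHom v (M.mulVec (fiberCoord v.Completion hI e x) k) *
      M.mulVec (fiberCoord v.Completion hI e y) k

theorem exists_isMetricMatrix (v : InfinitePlace K) : ∃ M, IsMetricMatrix E hI e v M :=
  letI := completionRCLike v
  exists_matrix_inner_eq_sum (𝕜 := v.Completion) (E.metric v) (fiberCoord v.Completion hI e)

end InfDetNorm

section

variable {K : Type u} [Field K] [NumberField K] (E : Bundle.{u, w₁} K)
  {r : ℕ} {I : Fin r → Ideal (𝓞 K)} (hI : ∀ i, I i ≠ ⊥) (e : E.carrier ≃ₗ[𝓞 K] ∀ i, I i)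

theorem infDetNorm_eq (v : InfinitePlace K) {M : Matrix (Fin r) (Fin r) v.Completion}
    (hM : IsMetricMatrix E hI e v M) (f : Fin r → E.InfFibre v) : E.infDetNorm v f =
      (‖M.det‖ * ‖(Matrix.of fun i j => fiberCoord v.Completion hI e (f j) i).det‖) ^ v.mult := by
  let := completionRCLike v
  have h := re_det_inner_eq (𝕜 := v.Completion) (E.metric v) (fiberCoord v.Completion hI e) hM.2 f
  unfold Bundle.infDetNorm
  refine (congrArg (fun t => √t ^ v.mult) h).trans ?_
  exact congrArg (· ^ v.mult) (Real.sqrt_sq (mul_nonneg (norm_nonneg _) (norm_nonneg _)))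

end

/-! ### The degree in terms of ideals and matrices. -/

section Degree

theorem norm_algebraMap_infinitePlace {K : Type u} [Field K] (v : InfinitePlace K) (x : K) :
    ‖algebraMap K v.Completion x‖ = v x :=
  InfinitePlace.Completion.norm_coe v ((WithAbs.equiv v.1).symm x)

variable {K : Type u} [Field K] [NumberField K] (E : Bundle.{u, w₁} K)

/-- The degree of a bundle whose underlying module is a product of ideals. -/
theorem degree_eq {I : Fin (Module.finrank K E.Generic) → Ideal (𝓞 K)} (hI : ∀ i, I i ≠ ⊥)
    (e : E.carrier ≃ₗ[𝓞 K] ∀ i, I i)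
    {M : ∀ v : InfinitePlace K, Matrix (Fin (Module.finrank K E.Generic))
      (Fin (Module.finrank K E.Generic)) v.Completion}
    (hM : ∀ v, IsMetricMatrix E hI e v (M v)) :
    E.degree = -Real.log ((∏ i, (Ideal.absNorm (I i) : ℝ)) * ∏ v, ‖(M v).det‖ ^ v.mult) := by
  let b := Module.finBasis K E.Generic
  -- `P` compares the basis chosen in the definition of the degree with the ideal coordinates. Its
  -- determinant appears at every place and disappears by the product formula.
  let P := Matrix.of fun i j => fiberCoord K hI e (b j) i
  have hP : P.det ≠ 0 := by
    have h1 : P = LinearMap.toMatrix b (Pi.basisFun K _) (fiberCoord K hI e).toLinearMap := by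
      ext i j
      simp [P, LinearMap.toMatrix_apply]
    rw [h1]
    exact ((fiberCoord K hI e).isUnit_det b (Pi.basisFun K _)).ne_zero
  have hfin : ∀ v : HeightOneSpectrum (𝓞 K), E.finDetNorm v (fun i => E.toFin v (b i)) =
      FinitePlace.equivHeightOneSpectrum.symm v P.det *
        ∏ i, (Ideal.absNorm (v.maxPowDividing (I i)) : ℝ) := by
    intro v
    rw [finDetNorm_eq E hI e v]
    congr 1
    change _ = ‖algebraMap K (v.adicCompletion K) P.det‖
    rw [RingHom.map_det]
    congr 2
    exact Matrix.ext fun i j => fiberCoord_rTensor K (v.adicCompletion K) hI e (b j) i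
  have hinf : ∀ v : InfinitePlace K, E.infDetNorm v (fun i => E.toInf v (b i)) =
      ‖(M v).det‖ ^ v.mult * v P.det ^ v.mult := by
    intro v
    rw [infDetNorm_eq E hI e v (hM v), mul_pow, ← norm_algebraMap_infinitePlace, RingHom.map_det]
    congr 4
    exact Matrix.ext fun i j => fiberCoord_rTensor K v.Completion hI e (b j) i
  have hprod : ∏ᶠ v : HeightOneSpectrum (𝓞 K), E.finDetNorm v (fun i => E.toFin v (b i)) =
      (∏ᶠ v : FinitePlace K, v P.det) * ∏ i, (Ideal.absNorm (I i) : ℝ) := by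
    rw [finprod_congr hfin, finprod_mul_distrib]
    · congr 1
      · exact finprod_comp_equiv FinitePlace.equivHeightOneSpectrum.symm
          (f := fun w : FinitePlace K => w P.det)
      · rw [finprod_prod_comm _ _ fun i _ => hasFiniteMulSupport_absNorm_maxPowDividing (hI i)]
        exact Finset.prod_congr rfl fun i _ => finprod_absNorm_maxPowDividing (hI i)
    · exact (FinitePlace.hasFiniteMulSupport hP).comp_of_injective
        FinitePlace.equivHeightOneSpectrum.symm.injective
    · exact Function.HasFiniteMulSupport.prod (fun i =>
        hasFiniteMulSupport_absNorm_maxPowDividing (hI i)) _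
  change -Real.log ((∏ᶠ v : HeightOneSpectrum (𝓞 K), E.finDetNorm v (fun i => E.toFin v (b i))) *
    ∏ v : InfinitePlace K, E.infDetNorm v fun i => E.toInf v (b i)) = _
  rw [hprod, Finset.prod_congr rfl fun v _ => hinf v, Finset.prod_mul_distrib,
    mul_comm (∏ᶠ v : FinitePlace K, v P.det), mul_mul_mul_comm, mul_comm (∏ᶠ v : FinitePlace K, _),
    prod_abs_eq_one hP, mul_one]

/-- Every bundle is, as a module, a product of ideals, and its degree is given by the norms of the
ideals and the determinants of its scalar products. -/
theorem exists_pi_ideal_degree_eq : ∃ (I : Fin E.rank → Ideal (𝓞 K)) (hI : ∀ i, I i ≠ ⊥)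
    (e : E.carrier ≃ₗ[𝓞 K] ∀ i, I i)
    (M : ∀ v : InfinitePlace K, Matrix (Fin E.rank) (Fin E.rank) v.Completion),
    (∀ v, IsMetricMatrix E hI e v (M v)) ∧
    E.degree = -Real.log ((∏ i, (Ideal.absNorm (I i) : ℝ)) * ∏ v, ‖(M v).det‖ ^ v.mult) := by
  obtain ⟨r, I, hI, ⟨e⟩⟩ := Module.Projective.exists_linearEquiv_pi_ideal (𝓞 K) E.carrier
  obtain rfl : r = E.rank := by
    rw [Bundle.rank, finrank_tensorProduct_of_pi_ideal K hI e, Fintype.card_fin]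
  choose M hM using exists_isMetricMatrix E hI e
  exact ⟨I, hI, e, M, hM, degree_eq E hI e hM⟩

end Degree

/-! ### Tensor products and global sections. -/

section IdealCoord

variable {R : Type*} [CommRing R] {A B : Type*} [AddCommGroup A] [Module R A] [AddCommGroup B]
  [Module R B] {ι κ : Type*} [Fintype ι] [DecidableEq ι] [Fintype κ] [DecidableEq κ]
  {I : ι → Ideal R} {J : κ → Ideal R}

/-- Products `a * b` generate `I i * J j`, and each is the only nonzero coordinate of a pure tensor.
This lifts the vector found by Minkowski's theorem to the tensor product of modules. -/
theorem exists_tensorCoord_idealCoord_eq (e : A ≃ₗ[R] ∀ i, I i) (e' : B ≃ₗ[R] ∀ j, J j)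
    {x : ι × κ → R} (hx : ∀ k, x k ∈ I k.1 * J k.2) :
    ∃ m : A ⊗[R] B, tensorCoord (idealCoord e) (idealCoord e') m = x := by
  change x ∈ LinearMap.range (tensorCoord (idealCoord e) (idealCoord e'))
  have hx' : x = ∑ k, Pi.single k (x k) := (Finset.univ_sum_single x).symm
  rw [hx']
  refine Submodule.sum_mem _ fun k _ => ?_
  have hle : I k.1 * J k.2 ≤ (LinearMap.range (tensorCoord (idealCoord e) (idealCoord e'))).comap
      (LinearMap.single R (fun _ : ι × κ => R) k) := by
    rw [Ideal.mul_le]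
    intro a ha b hb
    obtain ⟨m, hm⟩ := exists_idealCoord_eq_single e k.1 ha
    obtain ⟨m', hm'⟩ := exists_idealCoord_eq_single e' k.2 hb
    refine ⟨m ⊗ₜ m', funext fun j => ?_⟩
    rw [tensorCoord_tmul, hm, hm', LinearMap.single_apply]
    obtain ⟨k₁, k₂⟩ := k
    obtain ⟨j₁, j₂⟩ := j
    rcases eq_or_ne j₁ k₁ with rfl | h₁
    · rcases eq_or_ne j₂ k₂ with rfl | h₂
      · simp
      · simp [h₂]
    · simp [h₁]
  exact hle (hx k)

variable (L : Type*) [Field L] [Algebra R L] [Module.Flat R L] [FaithfulSMul R L]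

/-- On pure tensors this is the expansion of a product of two sums. It makes the Kronecker product
of two metric matrices one for the tensor product. -/
theorem tensorCoord_distribBaseChange (hI : ∀ i, I i ≠ ⊥) (hJ : ∀ j, J j ≠ ⊥)
    (e : A ≃ₗ[R] ∀ i, I i) (e' : B ≃ₗ[R] ∀ j, J j) (M : Matrix ι ι L) (N : Matrix κ κ L)
    (m : A ⊗[R] B) : tensorCoord (M.mulVecLin ∘ₗ (fiberCoord L hI e).toLinearMap)
      (N.mulVecLin ∘ₗ (fiberCoord L hJ e').toLinearMap)
      (TensorProduct.AlgebraTensorModule.distribBaseChange R L A B (1 ⊗ₜ m)) =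
    (Matrix.kronecker M N).mulVec
      fun k => algebraMap R L (tensorCoord (idealCoord e) (idealCoord e') m k) := by
  induction m with
  | zero =>
    simp only [TensorProduct.tmul_zero, map_zero, Pi.zero_apply]
    exact (Matrix.mulVec_zero _).symm
  | add a b ha hb =>
    simp only [TensorProduct.tmul_add, map_add, Pi.add_apply, ha, hb]
    exact (Matrix.mulVec_add _ _ _).symm
  | tmul a b =>
    ext k
    have h : TensorProduct.AlgebraTensorModule.distribBaseChange R L A B (1 ⊗ₜ (a ⊗ₜ b)) =
      ((1 : L) ⊗ₜ[R] a) ⊗ₜ[L] ((1 : L) ⊗ₜ[R] b) := by simp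
    rw [h, tensorCoord_tmul]
    simp only [LinearMap.comp_apply, Matrix.mulVecLin_apply, Matrix.mulVec, dotProduct,
      LinearEquiv.coe_coe, fiberCoord_tmul, one_mul, tensorCoord_tmul, map_mul]
    rw [Finset.sum_mul_sum, ← Finset.sum_product', Finset.univ_product_univ]
    exact Finset.sum_congr rfl fun j _ => mul_mul_mul_comm _ _ _ _

end IdealCoord

theorem distribBaseChange_one_tmul_rTensor {R : Type*} [CommRing R] {A A' B : Type*}
    [AddCommGroup A] [Module R A] [AddCommGroup A'] [Module R A'] [AddCommGroup B] [Module R B]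
    (L : Type*) [CommRing L] [Algebra R L] (f : A →ₗ[R] A') (m : A ⊗[R] B) :
    TensorProduct.AlgebraTensorModule.distribBaseChange R L A' B (1 ⊗ₜ f.rTensor B m) =
      TensorProduct.map (f.baseChange L) LinearMap.id
        (TensorProduct.AlgebraTensorModule.distribBaseChange R L A B (1 ⊗ₜ m)) := by
  induction m with
  | zero => simp
  | add a b ha hb => simp only [TensorProduct.tmul_add, map_add, ha, hb]
  | tmul a b => simp

section Sections

variable {K : Type u} [Field K] [NumberField K]

theorem finNorm_one_tmul_le_one (E : Bundle.{u, w₁} K) (v : HeightOneSpectrum (𝓞 K))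
    (m : E.carrier) : E.finNorm v (E.toFin v (1 ⊗ₜ m)) ≤ 1 := by
  refine csInf_le ⟨0, ?_⟩ ⟨1, norm_one.symm, 1 ⊗ₜ m, Submodule.subset_span ⟨m, rfl⟩, ?_⟩
  · rintro _ ⟨a, rfl, _⟩
    exact norm_nonneg a
  · rw [one_smul, Bundle.toFin, LinearMap.rTensor_tmul]
    simp

theorem one_tmul_ne_zero (E : Bundle.{u, w₁} K) {m : E.carrier} (hm : m ≠ 0) :
    (1 : K) ⊗ₜ[𝓞 K] m ≠ 0 := by
  have h := Module.Flat.rTensor_preserves_injective_linearMap (M := E.carrier)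
    (Algebra.linearMap (𝓞 K) K) (FaithfulSMul.algebraMap_injective (𝓞 K) K)
  intro h0
  have h1 : (1 : 𝓞 K) ⊗ₜ[𝓞 K] m = 0 := h (by simpa using h0)
  have h2 := congrArg (TensorProduct.lid (𝓞 K) E.carrier) h1
  simp at h2
  exact hm h2

/-- A short lattice vector gives a global section of a tensor product of bundles. -/
theorem exists_globalSection_ne_zero (E : Bundle.{u, w₁} K) (F : Bundle.{u, w₂} K)
    (p : Submodule (𝓞 K) E.carrier) (hp : IsComplemented p)
    {ι κ : Type*} [Fintype ι] [DecidableEq ι] [Fintype κ] [DecidableEq κ]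
    {I : ι → Ideal (𝓞 K)} {J : κ → Ideal (𝓞 K)} (hI : ∀ i, I i ≠ ⊥) (hJ : ∀ j, J j ≠ ⊥)
    (e : (E.sub p hp).carrier ≃ₗ[𝓞 K] ∀ i, I i) (e' : F.carrier ≃ₗ[𝓞 K] ∀ j, J j)
    {M : ∀ v : InfinitePlace K, Matrix ι ι v.Completion}
    {N : ∀ v : InfinitePlace K, Matrix κ κ v.Completion}
    (hM : ∀ v, IsMetricMatrix (E.sub p hp) hI e v (M v)) (hN : ∀ v, IsMetricMatrix F hJ e' v (N v))
    {x : ι × κ → 𝓞 K} (hx0 : x ≠ 0) (hx : ∀ k, x k ∈ I k.1 * J k.2)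
    (hxv : ∀ v, ∑ k, ‖(Matrix.kronecker (M v) (N v)).mulVec
      (fun i => algebraMap (𝓞 K) v.Completion (x i)) k‖ ^ 2 < 1) :
    ∃ s ∈ (E.tensor F).globalSections, s ≠ 0 := by
  obtain ⟨m, hm⟩ := exists_tensorCoord_idealCoord_eq e e' hx
  have hm0 : m ≠ 0 := by
    rintro rfl
    exact hx0 (by rw [← hm, map_zero])
  let m' : (E.tensor F).carrier := p.subtype.rTensor F.carrier m
  -- `F` is projective, hence flat, so tensoring the inclusion of `p` with it stays injective.
  have hm'0 : m' ≠ 0 := fun h => hm0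
    (Module.Flat.rTensor_preserves_injective_linearMap p.subtype p.injective_subtype
      (h.trans (map_zero _).symm))
  refine ⟨1 ⊗ₜ m', ⟨fun v => finNorm_one_tmul_le_one _ v m', fun v => ?_⟩,
    one_tmul_ne_zero _ hm'0⟩
  let := completionRCLike v
  have h1 : TensorProduct.AlgebraTensorModule.distribBaseChange (𝓞 K) v.Completion E.carrier
      F.carrier (1 ⊗ₜ m') = TensorProduct.map (p.subtype.baseChange v.Completion) LinearMap.id
      (TensorProduct.AlgebraTensorModule.distribBaseChange (𝓞 K) v.Completion p
        F.carrier (1 ⊗ₜ m)) :=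
    distribBaseChange_one_tmul_rTensor v.Completion p.subtype m
  have h5 := hxv v
  rw [← hm, ← tensorCoord_distribBaseChange v.Completion hI hJ e e' (M v) (N v)] at h5
  obtain ⟨u, hu⟩ : ∃ u : ι × κ → v.Completion, u = tensorCoord
    ((M v).mulVecLin ∘ₗ (fiberCoord v.Completion hI e).toLinearMap)
    ((N v).mulVecLin ∘ₗ (fiberCoord v.Completion hJ e').toLinearMap)
    (TensorProduct.AlgebraTensorModule.distribBaseChange (𝓞 K) v.Completion p
      F.carrier (1 ⊗ₜ m)) := ⟨_, rfl⟩
  have h2 : (tensorCore (𝕜 := v.Completion) (E.metric v) (F.metric v)).inner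
      (TensorProduct.map (p.subtype.baseChange v.Completion) LinearMap.id
        (TensorProduct.AlgebraTensorModule.distribBaseChange (𝓞 K) v.Completion p
          F.carrier (1 ⊗ₜ m)))
      (TensorProduct.map (p.subtype.baseChange v.Completion) LinearMap.id
        (TensorProduct.AlgebraTensorModule.distribBaseChange (𝓞 K) v.Completion p
          F.carrier (1 ⊗ₜ m))) = ∑ k, starRingEnd v.Completion (u k) * u k := by
    rw [hu]
    exact tensorCore_inner_map_eq_sum (𝕜 := v.Completion) (E.metric v) (F.metric v)
      (p.subtype.baseChange v.Completion) LinearMap.id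
      ((M v).mulVecLin ∘ₗ (fiberCoord v.Completion hI e).toLinearMap)
      ((N v).mulVecLin ∘ₗ (fiberCoord v.Completion hJ e').toLinearMap)
      (hM v).2 (hN v).2 _ _
  have h5' : ∑ k, ‖u k‖ ^ 2 < 1 := hu ▸ h5
  have h3 : (E.tensor F).toInf v (1 ⊗ₜ m') = 1 ⊗ₜ m' := by
    exact (LinearMap.rTensor_tmul _ _ _ _).trans
      (congrArg (fun a => a ⊗ₜ[𝓞 K] m') (map_one (algebraMap K v.Completion)))
  have h4 : ((E.tensor F).metric v).inner ((E.tensor F).toInf v (1 ⊗ₜ m'))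
      ((E.tensor F).toInf v (1 ⊗ₜ m')) = ∑ k, starRingEnd v.Completion (u k) * u k := by
    rw [h3]
    exact (congrArg (fun z => (tensorCore (𝕜 := v.Completion) (E.metric v) (F.metric v)).inner z z)
      h1).trans h2
  have h6 := (congrArg RCLike.re h4).trans (re_sum_conj_mul_self (𝕜 := v.Completion) u)
  refine pow_le_one₀ (Real.sqrt_nonneg _) (Real.sqrt_le_one.mpr ?_)
  exact h6.trans_le h5'.le

end Sections

/-! ### Lower bounds for ball volumes. -/

section BallVolumes

theorem realBallVolume_pos (N : ℕ) : 0 < realBallVolume N :=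
  div_pos (pow_pos (Real.sqrt_pos.mpr Real.pi_pos) _) (Real.Gamma_pos_of_pos (by positivity))

theorem complexBallVolume_pos (N : ℕ) : 0 < complexBallVolume N :=
  div_pos (pow_pos Real.pi_pos _) (Real.Gamma_pos_of_pos (by positivity))

theorem log_Gamma_add_one_le {x a : ℝ} (hx : 0 < x) (ha : 0 < a) (ha' : a < 1) :
    Real.log (Real.Gamma (x + 1)) ≤ x * (Real.log x - Real.log a - 1) - Real.log (1 - a) := by
  have h := Real.log_le_log (Real.Gamma_pos_of_pos (by positivity))
    (Real.Gamma_add_one_le_of_lt_one hx ha ha')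
  rw [Real.log_div (by positivity) (by linarith), Real.log_rpow (by positivity),
    Real.log_div (by positivity) (by positivity), Real.log_mul ha.ne' (Real.exp_ne_zero _),
    Real.log_exp] at h
  linarith

/-- The Gamma function stands in the denominator, so its upper bound is used. The error has a part
`log a` proportional to `N`, made small by taking `a` near `1`, and a part `log (1 - a)` independent
of `N`, absorbed for large `N`. -/
theorem le_log_realBallVolume {N : ℕ} (hN : 0 < N) {a : ℝ} (ha : 0 < a) (ha' : a < 1) :
    N / 2 * (Real.log Real.pi + 1 + Real.log 2 + Real.log a - Real.log N) + Real.log (1 - a) ≤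
      Real.log (realBallVolume N) := by
  have hN' : (0 : ℝ) < N := by exact_mod_cast hN
  have h := log_Gamma_add_one_le (x := N / 2) (by positivity) ha ha'
  rw [Real.log_div hN'.ne' two_ne_zero] at h
  rw [realBallVolume, Real.log_div (pow_ne_zero _ (Real.sqrt_pos.mpr Real.pi_pos).ne')
    (Real.Gamma_pos_of_pos (by positivity)).ne', Real.log_pow, Real.log_sqrt Real.pi_pos.le]
  linarith

theorem le_log_complexBallVolume {N : ℕ} (hN : 0 < N) {a : ℝ} (ha : 0 < a) (ha' : a < 1) :
    N * (Real.log Real.pi + 1 + Real.log a - Real.log N) + Real.log (1 - a) ≤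
      Real.log (complexBallVolume N) := by
  have hN' : (0 : ℝ) < N := by exact_mod_cast hN
  have h := log_Gamma_add_one_le (x := N) hN' ha ha'
  rw [complexBallVolume, Real.log_div (pow_ne_zero _ Real.pi_pos.ne')
    (Real.Gamma_pos_of_pos (by positivity)).ne', Real.log_pow]
  linarith

end BallVolumes

/-! ### Existence of a nonzero section from a degree bound. -/

section Existence

variable {K : Type u} [Field K] [NumberField K]

/-- There are subbundles of any given rank whose slope is arbitrarily close to the maximum. -/
theorem exists_sub_maxSlope_sub_lt_slope (E : Bundle.{u, w₁} K) {l : ℕ} (hl : l ≤ E.rank) {η : ℝ}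
    (hη : 0 < η) : ∃ (p : Submodule (𝓞 K) E.carrier) (hp : IsComplemented p),
      (E.sub p hp).rank = l ∧ E.maxSlope l - η < (E.sub p hp).slope := by
  have hne : {s : ℝ | ∃ (p : Submodule (𝓞 K) E.carrier) (hp : IsComplemented p),
      (E.sub p hp).rank = l ∧ s = (E.sub p hp).slope}.Nonempty := by
    obtain ⟨I, hI, e, -⟩ := exists_pi_ideal_degree_eq E
    obtain ⟨p, hp, ⟨g⟩⟩ := exists_isComplemented_linearEquiv_pi_ideal e hl
    refine ⟨_, p, hp, ?_, rfl⟩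
    exact (finrank_tensorProduct_of_pi_ideal K (fun i => hI _) g).trans (Fintype.card_fin l)
  obtain ⟨_, ⟨p, hp, hpl, rfl⟩, hs⟩ := exists_mem_sSup_sub_lt hne hη
  exact ⟨p, hp, hpl, hs⟩

/-- Minkowski's theorem for the tensor product of a subbundle with a bundle. -/
theorem exists_globalSection_ne_zero_of_degree (E : Bundle.{u, w₁} K) (F : Bundle.{u, w₂} K)
    (p : Submodule (𝓞 K) E.carrier) (hp : IsComplemented p) {l n : ℕ} (hl : (E.sub p hp).rank = l)
    (hn : F.rank = n)
    (h : (l * n : ℕ) * (Module.finrank ℚ K * Real.log 2 -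
        InfinitePlace.nrComplexPlaces K * Real.log 2 + Real.log |(discr K : ℝ)| / 2) -
        InfinitePlace.nrRealPlaces K * Real.log (realBallVolume (l * n)) -
        InfinitePlace.nrComplexPlaces K * Real.log (complexBallVolume (l * n)) <
      n * (E.sub p hp).degree + l * F.degree) :
    ∃ s ∈ (E.tensor F).globalSections, s ≠ 0 := by
  subst hl hn
  obtain ⟨I, hI, e, M, hM, hdE⟩ := exists_pi_ideal_degree_eq (E.sub p hp)
  obtain ⟨J, hJ, e', N, hN, hdF⟩ := exists_pi_ideal_degree_eq F
  have hnorm : ∀ {L : Ideal (𝓞 K)}, L ≠ ⊥ → (0 : ℝ) < Ideal.absNorm L := fun hL =>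
    Nat.cast_pos.mpr (Nat.pos_of_ne_zero (by rwa [ne_eq, Ideal.absNorm_eq_zero_iff]))
  have hIpos : 0 < ∏ i, (Ideal.absNorm (I i) : ℝ) := Finset.prod_pos fun i _ => hnorm (hI i)
  have hJpos : 0 < ∏ j, (Ideal.absNorm (J j) : ℝ) := Finset.prod_pos fun j _ => hnorm (hJ j)
  have hMpos : 0 < ∏ v, ‖(M v).det‖ ^ v.mult :=
    Finset.prod_pos fun v _ => pow_pos (norm_pos_iff.mpr (hM v).1) _
  have hNpos : 0 < ∏ v, ‖(N v).det‖ ^ v.mult :=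
    Finset.prod_pos fun v _ => pow_pos (norm_pos_iff.mpr (hN v).1) _
  have hdisc : (0 : ℝ) < |(discr K : ℝ)| :=
    abs_pos.mpr (Int.cast_ne_zero.mpr (discr_ne_zero K))
  have hcard : Fintype.card (Fin (E.sub p hp).rank × Fin F.rank) = (E.sub p hp).rank * F.rank := by simp
  -- The exponents here and in `hidealprod` are those of `deg (E' ⊗ F) = rk F * deg E' + rk E' * deg
  -- F`.
  have hdet : ∀ v, (Matrix.kronecker (M v) (N v)).det = (M v).det ^ F.rank * (N v).det ^ (E.sub p hp).rank := fun v => by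
    rw [Matrix.kronecker, Matrix.det_kronecker, Fintype.card_fin, Fintype.card_fin]
  have hidealprod : ∏ k : Fin (E.sub p hp).rank × Fin F.rank, (Ideal.absNorm (I k.1 * J k.2) : ℝ) =
      (∏ i, (Ideal.absNorm (I i) : ℝ)) ^ F.rank * (∏ j, (Ideal.absNorm (J j) : ℝ)) ^ (E.sub p hp).rank := by
    simp only [map_mul, Nat.cast_mul, Finset.prod_mul_distrib]
    rw [← Finset.univ_product_univ, Finset.prod_product, Finset.prod_product]
    simp [Finset.prod_pow]
  have hdetprod : ∏ v, (‖(Matrix.kronecker (M v) (N v)).det‖ ^ v.mult)⁻¹ =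
      ((∏ v, ‖(M v).det‖ ^ v.mult) ^ F.rank * (∏ v, ‖(N v).det‖ ^ v.mult) ^ (E.sub p hp).rank)⁻¹ := by
    rw [Finset.prod_inv_distrib, ← Finset.prod_pow, ← Finset.prod_pow, ← Finset.prod_mul_distrib]
    congr 1
    refine Finset.prod_congr rfl fun v _ => ?_
    rw [hdet, norm_mul, norm_pow, norm_pow]
    ring
  obtain ⟨x, hx0, hx, hxv⟩ := exists_ne_zero_mem_ideal_sum_norm_sq_lt_one
    (fun k : Fin (E.sub p hp).rank × Fin F.rank => I k.1 * J k.2)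
    (fun k => mul_ne_zero (hI k.1) (hJ k.2)) (fun v => Matrix.kronecker (M v) (N v))
    (fun v => by
      rw [hdet]
      exact mul_ne_zero (pow_ne_zero _ (hM v).1) (pow_ne_zero _ (hN v).1)) (by
    rw [hidealprod, hdetprod, hcard]
    have hR := realBallVolume_pos ((E.sub p hp).rank * F.rank)
    have hC := complexBallVolume_pos ((E.sub p hp).rank * F.rank)
    refine (Real.log_lt_log_iff (by positivity) (by positivity)).mp ?_
    rw [hdE, hdF, Real.log_mul hIpos.ne' hMpos.ne', Real.log_mul hJpos.ne' hNpos.ne'] at h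
    rw [Real.log_mul (by positivity) (by positivity), Real.log_mul (by positivity) (by positivity),
      Real.log_mul (by positivity) (by positivity), Real.log_mul (by positivity) (by positivity),
      Real.log_mul (by positivity) (by positivity), Real.log_inv,
      Real.log_mul (by positivity) (by positivity), Real.log_pow, Real.log_pow, Real.log_pow,
      Real.log_mul (by positivity) (by positivity), Real.log_pow, Real.log_pow, Real.log_pow,
      Real.log_pow, Real.log_pow, Real.log_pow, Real.log_inv, Real.log_sqrt (abs_nonneg _)]
    push_cast at h ⊢
    linarith)
  exact exists_globalSection_ne_zero E F p hp hI hJ e e' hM hN hx0 hx hxv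

end Existence

end Arakelov

end

/-! ### The main estimate. -/

theorem proposition4p3 (K : Type u) [Field K] [NumberField K] (ε : ℝ) (hε : 0 < ε) :
    ∃ n₀ : ℕ, ∀ E : Arakelov.Bundle.{u, w₁} K, Nontrivial E.carrier →
      ∀ n : ℕ, n₀ < n → ∀ μ : ℝ,
        (∃ l : ℕ, 1 ≤ l ∧ l ≤ E.rank ∧
          (Module.finrank ℚ K : ℝ) / 2 *
              (Real.log n + Real.log l - Real.log Real.pi - 1 + Real.log 2 + ε) +
            Real.log |(NumberField.discr K : ℝ)| / 2 ≤ E.maxSlope l + μ) →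
        ¬ ∃ F : Arakelov.Bundle.{u, w₂} K,
          F.rank = n ∧ F.slope = μ ∧ (E.tensor F).globalSections = {0} := by
  -- The hypothesis leaves a margin of `d * ε / 2` per unit of `N = l * n`. It is spent as `d * ε /
  -- 8` on `log a = -ε / 4`, `d * ε / 8` on the supremum of slopes, and `d * ε / 4` on the constant
  -- term `log (1 - a)`.
  obtain ⟨a, ha⟩ : ∃ a, a = Real.exp (-(ε / 4)) := ⟨_, rfl⟩
  have ha0 : 0 < a := ha ▸ Real.exp_pos _
  have ha1 : a < 1 := ha ▸ Real.exp_lt_one_iff.mpr (by linarith)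
  have hloga : Real.log a = -(ε / 4) := ha ▸ Real.log_exp _
  -- This makes `-log (1 - a) < n * ε / 4`; the bound depends on `ε` alone.
  refine ⟨⌈-Real.log (1 - a) * 4 / ε⌉₊, ?_⟩
  rintro E - n hn μ ⟨l, hl1, hl, hle⟩ ⟨F, hFn, hFμ, hF⟩
  set d : ℝ := (Module.finrank ℚ K : ℝ) with hd
  have hdpos : 0 < d := Nat.cast_pos.mpr Module.finrank_pos
  obtain ⟨p, hp, hpl, hps⟩ := Arakelov.exists_sub_maxSlope_sub_lt_slope E hl
    (η := d * ε / 8) (by positivity)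
  have hn0 : 0 < n := by omega
  have hn' : (0 : ℝ) < n := by exact_mod_cast hn0
  have hl' : (1 : ℝ) ≤ l := by exact_mod_cast hl1
  have hdegE : (E.sub p hp).degree = l * (E.sub p hp).slope := by
    rw [Arakelov.Bundle.slope, hpl]
    field_simp
  have hdegF : F.degree = n * μ := by
    rw [← hFμ, Arakelov.Bundle.slope, hFn]
    field_simp
  obtain ⟨s, hs, hs0⟩ := Arakelov.exists_globalSection_ne_zero_of_degree E F p hp hpl hFn (by
    have hR := Arakelov.le_log_realBallVolume (N := l * n) (by positivity) ha0 ha1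
    have hC := Arakelov.le_log_complexBallVolume (N := l * n) (by positivity) ha0 ha1
    have hsig : (InfinitePlace.nrRealPlaces K : ℝ) + 2 * InfinitePlace.nrComplexPlaces K = d := by
      rw [hd, ← InfinitePlace.card_add_two_mul_card_eq_rank K]
      push_cast
      rfl
    have hr1 : (0 : ℝ) ≤ InfinitePlace.nrRealPlaces K := Nat.cast_nonneg _
    have hr2 : (0 : ℝ) ≤ InfinitePlace.nrComplexPlaces K := Nat.cast_nonneg _
    have hR' := mul_le_mul_of_nonneg_left hR hr1
    have hC' := mul_le_mul_of_nonneg_left hC hr2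
    have hlog1 : Real.log (1 - a) < 0 := Real.log_neg (by linarith) (by linarith)
    have hnlog : -Real.log (1 - a) * 4 < n * ε := by
      rw [← div_lt_iff₀ hε]
      exact (Nat.le_ceil _).trans_lt (by exact_mod_cast hn)
    rw [hdegE, hdegF]
    push_cast at hR' hC' ⊢
    rw [Real.log_mul (by positivity) hn'.ne', hloga] at hR' hC'
    set L := Real.log (1 - a)
    set r₁ : ℝ := (InfinitePlace.nrRealPlaces K : ℝ)
    set r₂ : ℝ := (InfinitePlace.nrComplexPlaces K : ℝ)
    have hN : (n : ℝ) ≤ l * n := le_mul_of_one_le_left hn'.le hl'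
    have hNpos : (0 : ℝ) < l * n := by positivity
    have hslopes := mul_lt_mul_of_pos_left
      (show d / 2 * (Real.log n + Real.log l - Real.log Real.pi - 1 + Real.log 2 + ε) +
        Real.log |(discr K : ℝ)| / 2 - d * ε / 8 < (E.sub p hp).slope + μ by linarith) hNpos
    have herr : -(r₁ + r₂) * L < l * n * (d * ε / 4) := by
      have h1 : -(r₁ + r₂) * L ≤ d * -L := by nlinarith
      have h2 : d * (-L * 4) < d * (n * ε) := mul_lt_mul_of_pos_left hnlog hdpos
      have h3 : d * ε * n ≤ d * ε * (l * n) := mul_le_mul_of_nonneg_left hN (by positivity)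
      linarith
    -- Eliminating `r₁` turns the coefficient `d - r₂ - r₁ / 2` of `log 2` into `d / 2`, so that the
    -- estimate is linear in the given inequalities.
    have hr₁ : r₁ = d - 2 * r₂ := by linarith
    rw [hr₁] at hR' herr ⊢
    linarith)
  rw [hF] at hs
  exact hs0 hs
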